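/- Let $n\ge 1$, $p,q\in[1,\infty)$, $\alpha\in\mathbb R$ and $\alpha_0:=n\left(\frac1q-\frac1p\right)$. Cubes in $\mathbb R^n$ have edges parallel to the axes and finite positive edge length (and need be neither open nor closed). For $\ell\in(0,\infty)$ let $\Pi_\ell$ be the class of all collections $\{Q_j\}_j$ of cubes of $\mathbb R^n$ with pairwise disjoint interiors and edge length $\ell$. All functions are real- or complex-valued on $\mathbb R^n$, $f_Q:=\frac1{|Q|}\int_Q f$, and we use the following spaces. - $JNQ^{\alpha}_{p,q}(\mathbb R^n)$: all measurable $f$ with $$\sup_{\ell\in(0,\infty),\ \{Q_j\}_j\in\Pi_\ell}\Big\{\sum_j|Q_j|\Big[|Q_j|^{\frac{q\alpha}n-1}\int_{Q_j}\int_{Q_j}\frac{|f(x)-f(y)|^q}{|x-y|^{n+q\alpha}}\,dy\,dx\Big]^{p/q}\Big\}^{1/p}<\infty .$$ - $JN^{\rm con}_{p,q}(\mathbb R^n)$: all $f\in L^1_{\rm loc}(\mathbb R^n)$ with $$\sup_{\ell\in(0,\infty),\ \{Q_j\}_j\in\Pi_\ell}\Big\{\sum_j|Q_j|\Big[\frac1{|Q_j|}\int_{Q_j}|f(x)-f_{Q_j}|^q\,dx\Big]^{p/q}\Big\}^{1/p}<\infty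 .$$ - $W^{s,q}(\mathbb R^n)$, $s\in\mathbb R$: all measurable $f$ with $\int_{\mathbb R^n}\int_{\mathbb R^n}\frac{|f(x)-f(y)|^q}{|x-y|^{n+sq}}\,dx\,dy<\infty$. - $\dot W^{1,\gamma}(\mathbb R^n)$, $\gamma\in(0,\infty)$: all weakly differentiable $f$ with $\int_{\mathbb R^n}|\nabla f(x)|^{\gamma}\,dx<\infty$. - $\{0\}$ denotes the set of all functions that are almost everywhere equal to a constant. Then the following hold, where equality and inclusion are those of sets of functions. (i) If $\alpha_0<0$, then $JNQ^{\alpha}_{p,q}(\mathbb R^n)=\{0\}$. (ii) If $\alpha_0=0$, then $JNQ^{\alpha}_{p,q}(\mathbb R^n)=JN^{\rm con}_{p,p}(\mathbb R^n)$ for $\alpha\in(-\infty,0)$, and $JNQ^{\alpha}_{p,q}(\mathbb R^n)=\{0\}$ for $\alpha\in[0,\infty)$. (iii) If $\alpha_0\in(0,1)$, then $JNQ^{\alpha}_{p,q}(\mathbb R^n)=JN^{\rm con}_{p,q}(\mathbb R^n)$ for $\alpha\in(-\infty,0)$, $JNQ^{\alpha}_{p,q}(\mathbb R^n)\supset W^{\alpha_0,q}(\mathbb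 R^n)$ for $\alpha\in[0,\alpha_0]$, and $JNQ^{\alpha}_{p,q}(\mathbb R^n)=\{0\}$ for $\alpha\in(\alpha_0,\infty)$. (iv) If $\alpha_0\in[1,\infty)$, then $JNQ^{\alpha}_{p,q}(\mathbb R^n)=JN^{\rm con}_{p,q}(\mathbb R^n)$ for $\alpha\in(-\infty,0)$, $JNQ^{\alpha}_{p,q}(\mathbb R^n)\supset \dot W^{1,(\frac1p+\frac1n)^{-1}}(\mathbb R^n)$ for $\alpha\in[0,1)$, and $JNQ^{\alpha}_{p,q}(\mathbb R^n)=\{0\}$ for $\alpha\in[1,\infty)$. -/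

import Mathlib

open MeasureTheory Set
open scoped ENNReal

namespace JNQSpaces

/-- `Q` is a cube in `ℝⁿ` of edge length `ℓ` with edges parallel to the coordinate axes: a product
of intervals of length `ℓ`, each of which may or may not contain its endpoints. -/
def IsCube {n : ℕ} (ℓ : ℝ) (Q : Set (EuclideanSpace ℝ (Fin n))) : Prop :=
  ∃ (a : EuclideanSpace ℝ (Fin n)) (I : Fin n → Set ℝ),
    (∀ i, Ioo (a i) (a i + ℓ) ⊆ I i ∧ I i ⊆ Icc (a i) (a i + ℓ)) ∧ Q = {x | ∀ i, x i ∈ I i}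

/-- The class `Π_ℓ` of all collections of cubes of `ℝⁿ` with pairwise disjoint interiors and equal
edge length `ℓ`. -/
def congruentCollections (n : ℕ) (ℓ : ℝ) : Set (Set (Set (EuclideanSpace ℝ (Fin n)))) :=
  {S | (∀ Q ∈ S, IsCube ℓ Q) ∧ S.PairwiseDisjoint interior}

/-- For a nonnegative set function `Φ`, the quantity
`sup { (∑_j |Q_j| Φ(Q_j)^p)^{1/p} : 0 < ℓ < ∞, {Q_j}_j ∈ Π_ℓ }`. -/
noncomputable def congruentSup {n : ℕ} (p : ℝ) (Φ : Set (EuclideanSpace ℝ (Fin n)) → ℝ≥0∞) :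
    ℝ≥0∞ :=
  ⨆ (ℓ : ℝ) (_ : 0 < ℓ) (S ∈ congruentCollections n ℓ),
    (∑' Q : S, volume (Q : Set (EuclideanSpace ℝ (Fin n))) * Φ Q ^ p) ^ (1 / p)

section Spaces

variable {𝕜 : Type*} [RCLike 𝕜] {n : ℕ}

/-- The mean oscillation `(⨍_Q |f(x) - f_Q|^q dx)^{1/q}`, where `f_Q = ⨍_Q f`. -/
noncomputable def meanOsc (q : ℝ) (f : EuclideanSpace ℝ (Fin n) → 𝕜)
    (Q : Set (EuclideanSpace ℝ (Fin n))) : ℝ≥0∞ :=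
  ((volume Q)⁻¹ * ∫⁻ x in Q, ‖f x - ⨍ y in Q, f y‖ₑ ^ q) ^ (1 / q)

/-- `Φ_{f,q,α}(Q) = (|Q|^{qα/n - 1} ∫_Q ∫_Q |f(x) - f(y)|^q / |x - y|^{n + qα} dy dx)^{1/q}`. -/
noncomputable def phi (q α : ℝ) (f : EuclideanSpace ℝ (Fin n) → 𝕜)
    (Q : Set (EuclideanSpace ℝ (Fin n))) : ℝ≥0∞ :=
  (volume Q ^ (q * α / n - 1) *
    ∫⁻ x in Q, ∫⁻ y in Q, ‖f x - f y‖ₑ ^ q / ‖x - y‖ₑ ^ (n + q * α)) ^ (1 / q)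

/-- `g` is the weak gradient of the (weakly differentiable) function `f`: both are locally
integrable and `∫ f ∂_i φ = - ∫ g_i φ` for all test functions `φ` and all `i`. -/
def IsWeakGradient (f : EuclideanSpace ℝ (Fin n) → 𝕜)
    (g : EuclideanSpace ℝ (Fin n) → EuclideanSpace 𝕜 (Fin n)) : Prop :=
  LocallyIntegrable f volume ∧ LocallyIntegrable g volume ∧
    ∀ φ : EuclideanSpace ℝ (Fin n) → ℝ, ContDiff ℝ (⊤ : ℕ∞) φ → HasCompactSupport φ → ∀ i : Fin n,
      ∫ x, fderiv ℝ φ x (EuclideanSpace.single i 1) • f x = -∫ x, φ x • g x i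

variable (𝕜 n)

/-- The space `JNQ^α_{p,q}(ℝⁿ)`. -/
def JNQ (p q α : ℝ) : Set (EuclideanSpace ℝ (Fin n) → 𝕜) :=
  {f | AEStronglyMeasurable f volume ∧ congruentSup p (phi q α f) < ∞}

/-- The congruent John–Nirenberg space `JN^con_{p,q}(ℝⁿ)`. -/
def JNcon (p q : ℝ) : Set (EuclideanSpace ℝ (Fin n) → 𝕜) :=
  {f | LocallyIntegrable f volume ∧ congruentSup p (meanOsc q f) < ∞}

/-- The fractional Sobolev space `W^{s,q}(ℝⁿ)`: measurable functions with finite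
(Gagliardo) seminorm `(∫∫ |f(x) - f(y)|^q / |x - y|^{n + sq} dx dy)^{1/q}`. -/
def fracSobolev (s q : ℝ) : Set (EuclideanSpace ℝ (Fin n) → 𝕜) :=
  {f | AEStronglyMeasurable f volume ∧
    (∫⁻ x, ∫⁻ y, ‖f x - f y‖ₑ ^ q / ‖x - y‖ₑ ^ (n + s * q)) ^ (1 / q) < ∞}

/-- The homogeneous Sobolev space of all weakly differentiable functions `f` with
`(∫ |∇f|^γ)^{1/γ} < ∞`. -/
def homSobolev (γ : ℝ) : Set (EuclideanSpace ℝ (Fin n) → 𝕜) :=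
  {f | ∃ g, IsWeakGradient f g ∧ (∫⁻ x, ‖g x‖ₑ ^ γ) ^ (1 / γ) < ∞}

/-- The trivial space: functions on `ℝⁿ` that are almost everywhere equal to a constant. -/
def aeConstants : Set (EuclideanSpace ℝ (Fin n) → 𝕜) :=
  {f | ∃ c : 𝕜, f =ᵐ[volume] fun _ => c}

end Spaces

end JNQSpaces

open JNQSpaces

/-! The whole theorem is read off the double integral `energy q β f Q Q` with β = n + qα. Since |Q|
= ℓ^n, the summand |Q| Φ(Q)^p equals (ℓ^{q(α-α₀)} · energy)^{p/q} (`volume_mul_phi_rpow_eq`).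
Testing the supremum K on one cube gives energy ≤ K^q ℓ^{q(α₀-α)} (`energy_le_congruentSup`).

Triviality has four sources. If α > α₀, the bound tends to 0 as ℓ → ∞ while the energy of a fixed
cube only increases to that of the large one. If α₀ < 0, the unweighted energy of a fixed cube A is
compared with that of a large cube Q by averaging over a third point in Q (`volume_mul_energy_le`),
which leaves a factor ℓ^{qα₀}. If p = q and α = 0, all cubes have energy at most K^p, yet each
dyadic annulus around A contributes a fixed multiple of the unweighted energy of A; the latter must
vanish (`JNQ_zero_eq_aeConstants`). If α ≥ 1, the energy with kernel |x-y|^{-(n+q)} is locally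
finite; splitting an increment into m equal steps transfers the integral over |h| < R to |h| < R/m
without loss, and absolute continuity makes it zero (`mem_aeConstants_of_energy_ne_top`).

For α < 0 the kernel is integrable near the diagonal, so Φ is at most a constant times the mean
oscillation (`exists_phi_le_mul_meanOsc`). The converse bound is `exists_energy_zero_le`, where a
third point far from both x and y compensates for a kernel that may vanish on the diagonal.

Both embeddings bound |Q| Φ(Q)^p by a power at least 1 of the integral over Q of a globally
integrable density; disjointness and ℓ¹ ⊂ ℓ^r then sum the cubes. For the fractional Sobolev space
the density is the Gagliardo integrand. For the homogeneous Sobolev space it is |∇f|^γ: mollify, use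
the fundamental theorem of calculus along segments inside the convex cube
(`exists_energy_le_of_forall_le`), and pass to the limit by Fatou. -/

namespace JNQSpaces

/-! ### Geometry and measure of cubes, and summation over disjoint cubes -/

section Cubes

variable {n : ℕ}

/-- The open cube with lower corner `a` and edge length `ℓ`. -/
def openCube (a : EuclideanSpace ℝ (Fin n)) (ℓ : ℝ) : Set (EuclideanSpace ℝ (Fin n)) :=
  {x | ∀ i, x i ∈ Ioo (a i) (a i + ℓ)}

theorem isCube_openCube (a : EuclideanSpace ℝ (Fin n)) (ℓ : ℝ) : IsCube ℓ (openCube a ℓ) :=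
  ⟨a, fun i => Ioo (a i) (a i + ℓ), fun _ => ⟨subset_rfl, Ioo_subset_Icc_self⟩, rfl⟩

theorem isOpen_openCube (a : EuclideanSpace ℝ (Fin n)) (ℓ : ℝ) : IsOpen (openCube a ℓ) := by
  have h : openCube a ℓ =
      ⋂ i, (fun x : EuclideanSpace ℝ (Fin n) => x i) ⁻¹' Ioo (a i) (a i + ℓ) := by
    ext x
    simp [openCube]
  rw [h]
  exact isOpen_iInter_of_finite fun i => isOpen_Ioo.preimage (by fun_prop)

theorem convex_openCube (a : EuclideanSpace ℝ (Fin n)) (ℓ : ℝ) : Convex ℝ (openCube a ℓ) := by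
  intro x hx y hy s t hs ht hst i
  exact convex_Ioo (a i) (a i + ℓ) (hx i) (hy i) hs ht hst

theorem volume_setOf_forall_mem (I : Fin n → Set ℝ) :
    volume {x : EuclideanSpace ℝ (Fin n) | ∀ i, x i ∈ I i} = ∏ i, volume (I i) := by
  rw [← volume_pi_pi, ← (EuclideanSpace.volume_preserving_symm_measurableEquiv_toLp
    (Fin n)).measure_preimage_equiv]
  congr 1
  ext x
  simp

theorem volume_openCube (a : EuclideanSpace ℝ (Fin n)) (ℓ : ℝ) :
    volume (openCube a ℓ) = ENNReal.ofReal ℓ ^ n := by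
  rw [openCube, volume_setOf_forall_mem (fun i => Ioo (a i) (a i + ℓ))]
  simp

/-- The boundary convention of a cube is irrelevant: the closed and the open cube have the same
finite volume. This is the source of every measurability, volume and diameter fact about arbitrary
cubes. -/
theorem IsCube.exists_openCube {ℓ : ℝ} {Q : Set (EuclideanSpace ℝ (Fin n))} (hQ : IsCube ℓ Q) :
    ∃ a, openCube a ℓ ⊆ Q ∧ Q ⊆ {x | ∀ i, x i ∈ Icc (a i) (a i + ℓ)} ∧
      Q =ᵐ[volume] openCube a ℓ := by
  obtain ⟨a, I, hI, rfl⟩ := hQ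
  have h1 : openCube a ℓ ⊆ {x | ∀ i, x i ∈ I i} := fun x hx i => (hI i).1 (hx i)
  have h2 : {x : EuclideanSpace ℝ (Fin n) | ∀ i, x i ∈ I i} ⊆
    {x | ∀ i, x i ∈ Icc (a i) (a i + ℓ)} := fun x hx i => (hI i).2 (hx i)
  refine ⟨a, h1, h2, ?_⟩
  refine (ae_eq_of_subset_of_measure_ge h1 ?_ (isOpen_openCube a ℓ).nullMeasurableSet
    ?_).symm
  · refine (measure_mono h2).trans ?_
    rw [volume_openCube, volume_setOf_forall_mem (fun i => Icc (a i) (a i + ℓ))]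
    simp
  · refine ((measure_mono h2).trans_lt ?_).ne
    rw [volume_setOf_forall_mem (fun i => Icc (a i) (a i + ℓ))]
    simp

theorem IsCube.volume_eq {ℓ : ℝ} {Q : Set (EuclideanSpace ℝ (Fin n))} (hQ : IsCube ℓ Q) :
    volume Q = ENNReal.ofReal ℓ ^ n := by
  obtain ⟨a, -, -, h⟩ := hQ.exists_openCube
  rw [measure_congr h, volume_openCube]

theorem IsCube.volume_eq_rpow {ℓ : ℝ} {Q : Set (EuclideanSpace ℝ (Fin n))} (hQ : IsCube ℓ Q) :
    volume Q = ENNReal.ofReal ℓ ^ (n : ℝ) := by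
  rw [hQ.volume_eq, ENNReal.rpow_natCast]

theorem IsCube.volume_ne_zero {ℓ : ℝ} (hℓ : 0 < ℓ) {Q : Set (EuclideanSpace ℝ (Fin n))}
    (hQ : IsCube ℓ Q) : volume Q ≠ 0 := by
  rw [hQ.volume_eq]
  exact pow_ne_zero _ (by simpa using hℓ)

theorem IsCube.volume_ne_top {ℓ : ℝ} {Q : Set (EuclideanSpace ℝ (Fin n))}
    (hQ : IsCube ℓ Q) : volume Q ≠ ∞ := by
  rw [hQ.volume_eq]
  exact ENNReal.pow_ne_top (by simp)

theorem norm_le_sqrt_mul {x : EuclideanSpace ℝ (Fin n)} {r : ℝ} (hr : 0 ≤ r)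
    (h : ∀ i, |x i| ≤ r) : ‖x‖ ≤ √n * r := by
  rw [EuclideanSpace.norm_eq]
  calc √(∑ i, ‖x i‖ ^ 2) ≤ √(∑ _i : Fin n, r ^ 2) := by
        refine Real.sqrt_le_sqrt (Finset.sum_le_sum fun i _ => ?_)
        exact pow_le_pow_left₀ (norm_nonneg _) (h i) 2
    _ = √n * r := by
        rw [Finset.sum_const, Finset.card_univ, Fintype.card_fin, nsmul_eq_mul,
          Real.sqrt_mul (by positivity), Real.sqrt_sq hr]

theorem IsCube.enorm_sub_le {ℓ : ℝ} (hℓ : 0 < ℓ) {Q : Set (EuclideanSpace ℝ (Fin n))}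
    (hQ : IsCube ℓ Q) {x y : EuclideanSpace ℝ (Fin n)} (hx : x ∈ Q) (hy : y ∈ Q) :
    ‖x - y‖ₑ ≤ ENNReal.ofReal (√n * ℓ) := by
  obtain ⟨a, -, h, -⟩ := hQ.exists_openCube
  rw [← ofReal_norm]
  refine ENNReal.ofReal_le_ofReal (norm_le_sqrt_mul hℓ.le fun i => ?_)
  have h1 := h hx i
  have h2 := h hy i
  simp only [mem_Icc] at h1 h2
  rw [PiLp.sub_apply, abs_le]
  constructor <;> linarith [h1.1, h1.2, h2.1, h2.2]

theorem IsCube.ae_eq_interior {ℓ : ℝ} {Q : Set (EuclideanSpace ℝ (Fin n))} (hQ : IsCube ℓ Q) :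
    Q =ᵐ[volume] interior Q := by
  obtain ⟨a, h1, -, h2⟩ := hQ.exists_openCube
  have h3 : openCube a ℓ ⊆ interior Q := interior_maximal h1 (isOpen_openCube a ℓ)
  refine Filter.EventuallyLE.antisymm ?_ (Filter.Eventually.of_forall interior_subset)
  exact h2.le.trans (Filter.Eventually.of_forall h3)

theorem IsCube.nullMeasurableSet {ℓ : ℝ} {Q : Set (EuclideanSpace ℝ (Fin n))}
    (hQ : IsCube ℓ Q) : NullMeasurableSet Q volume :=
  isOpen_interior.nullMeasurableSet.congr hQ.ae_eq_interior.symm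

theorem countable_of_mem_congruentCollections {ℓ : ℝ} (hℓ : 0 < ℓ)
    {S : Set (Set (EuclideanSpace ℝ (Fin n)))} (hS : S ∈ congruentCollections n ℓ) :
    S.Countable := by
  refine hS.2.countable_of_isOpen (fun _ _ => isOpen_interior) fun Q hQ => ?_
  refine nonempty_of_measure_ne_zero (μ := volume) ?_
  rw [← measure_congr (hS.1 Q hQ).ae_eq_interior]
  exact (hS.1 Q hQ).volume_ne_zero hℓ

/-- Only the interiors are disjoint, so each cube is first replaced by its interior, at the cost of
a null set; being nonempty disjoint open sets, these are countably many. -/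
theorem tsum_setLIntegral_le {ℓ : ℝ} (hℓ : 0 < ℓ)
    {S : Set (Set (EuclideanSpace ℝ (Fin n)))} (hS : S ∈ congruentCollections n ℓ)
    (F : EuclideanSpace ℝ (Fin n) → ℝ≥0∞) :
    ∑' Q : S, ∫⁻ x in (Q : Set (EuclideanSpace ℝ (Fin n))), F x ≤ ∫⁻ x, F x := by
  have : Countable S := (countable_of_mem_congruentCollections hℓ hS).to_subtype
  calc ∑' Q : S, ∫⁻ x in (Q : Set (EuclideanSpace ℝ (Fin n))), F x
      = ∑' Q : S, ∫⁻ x in interior (Q : Set (EuclideanSpace ℝ (Fin n))), F x := by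
        refine tsum_congr fun Q => ?_
        rw [Measure.restrict_congr_set (hS.1 Q Q.2).ae_eq_interior]
    _ = ∫⁻ x in ⋃ Q : S, interior (Q : Set (EuclideanSpace ℝ (Fin n))), F x :=
        (lintegral_iUnion (fun _ => isOpen_interior.measurableSet)
          (fun (Q R : S) hQR => hS.2 Q.2 R.2 (by simpa [Subtype.ext_iff] using hQR)) F).symm
    _ ≤ ∫⁻ x, F x := setLIntegral_le_lintegral _ _

/-- The inclusion ℓ¹ ⊂ ℓ^r: split off one factor a i and bound the other r - 1 by the total sum. -/
theorem tsum_rpow_le_rpow_tsum {ι : Type*} (a : ι → ℝ≥0∞) {r : ℝ} (hr : 1 ≤ r) :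
    ∑' i, a i ^ r ≤ (∑' i, a i) ^ r := by
  calc ∑' i, a i ^ r = ∑' i, a i * a i ^ (r - 1) := by
        refine tsum_congr fun i => ?_
        conv_rhs => rw [← ENNReal.rpow_one (a i), ENNReal.rpow_one (a i)]
        conv_lhs => rw [show r = 1 + (r - 1) by ring,
          ENNReal.rpow_add_of_nonneg _ _ zero_le_one (by linarith), ENNReal.rpow_one]
    _ ≤ ∑' i, a i * (∑' i, a i) ^ (r - 1) := by
        refine ENNReal.tsum_le_tsum fun i => ?_
        exact mul_le_mul_right (ENNReal.rpow_le_rpow (ENNReal.le_tsum i) (by linarith)) _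
    _ = (∑' i, a i) ^ r := by
        rw [ENNReal.tsum_mul_right]
        conv_rhs => rw [show r = 1 + (r - 1) by ring,
          ENNReal.rpow_add_of_nonneg _ _ zero_le_one (by linarith), ENNReal.rpow_one]

/-- The open cube with centre `0` and edge length `2 * R`. -/
def centeredCube (n : ℕ) (R : ℝ) : Set (EuclideanSpace ℝ (Fin n)) :=
  {x | ∀ i, x i ∈ Ioo (-R) R}

theorem centeredCube_eq (R : ℝ) :
    centeredCube n R = openCube (WithLp.toLp 2 fun _ => -R) (2 * R) := by
  ext x
  have h : -R + 2 * R = R := by ring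
  simp [centeredCube, openCube, h]

theorem isCube_centeredCube (R : ℝ) : IsCube (2 * R) (centeredCube n R) := by
  rw [centeredCube_eq]
  exact isCube_openCube _ _

theorem isOpen_centeredCube (R : ℝ) : IsOpen (centeredCube n R) := by
  rw [centeredCube_eq]
  exact isOpen_openCube _ _

theorem volume_centeredCube (R : ℝ) :
    volume (centeredCube n R) = ENNReal.ofReal (2 * R) ^ n :=
  (isCube_centeredCube R).volume_eq

theorem centeredCube_mono {r R : ℝ} (h : r ≤ R) : centeredCube n r ⊆ centeredCube n R :=
  fun _ hx i => ⟨by linarith [(hx i).1], by linarith [(hx i).2]⟩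

theorem add_mem_centeredCube {r s : ℝ} {x y : EuclideanSpace ℝ (Fin n)}
    (hx : x ∈ centeredCube n r) (hy : ‖y‖ < s) : x + y ∈ centeredCube n (r + s) := by
  intro i
  have h1 := hx i
  have h2 := abs_lt.1 (((PiLp.norm_apply_le y i).trans_lt hy))
  simp only [mem_Ioo, PiLp.add_apply] at h1 ⊢
  constructor <;> linarith [h1.1, h1.2, h2.1, h2.2]

theorem mem_centeredCube {s : ℝ} {x : EuclideanSpace ℝ (Fin n)} (hx : ‖x‖ < s) :
    x ∈ centeredCube n s := fun i => abs_lt.1 ((PiLp.norm_apply_le x i).trans_lt hx)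

theorem exists_nat_forall_mem_centeredCube (x : EuclideanSpace ℝ (Fin n)) :
    ∃ N : ℕ, ∀ k : ℕ, N ≤ k → x ∈ centeredCube n k := by
  obtain ⟨N, hN⟩ := exists_nat_gt ‖x‖
  exact ⟨N, fun k hk => mem_centeredCube (hN.trans_le (by exact_mod_cast hk))⟩

end Cubes

/-! ### Bounding and testing the congruent supremum -/

section CongruentSup

variable {n : ℕ} {p : ℝ} {Φ Ψ : Set (EuclideanSpace ℝ (Fin n)) → ℝ≥0∞}

theorem congruentSup_lt_top (hp : 0 < p) {C : ℝ≥0∞} (hC : C ≠ ∞)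
    (h : ∀ ℓ : ℝ, 0 < ℓ → ∀ S ∈ congruentCollections n ℓ,
      ∑' Q : S, volume (Q : Set (EuclideanSpace ℝ (Fin n))) * Φ Q ^ p ≤ C) :
    congruentSup p Φ < ∞ := by
  refine lt_of_le_of_lt (b := C ^ (1 / p)) ?_ ?_
  · refine iSup₂_le fun ℓ hℓ => iSup₂_le fun S hS => ?_
    exact ENNReal.rpow_le_rpow (h ℓ hℓ S hS) (by positivity)
  · exact (ENNReal.rpow_lt_top_of_nonneg (by positivity) hC)

theorem tsum_le_congruentSup_rpow (hp : 0 < p) {ℓ : ℝ} (hℓ : 0 < ℓ)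
    {S : Set (Set (EuclideanSpace ℝ (Fin n)))} (hS : S ∈ congruentCollections n ℓ) :
    ∑' Q : S, volume (Q : Set (EuclideanSpace ℝ (Fin n))) * Φ Q ^ p ≤ congruentSup p Φ ^ p := by
  rw [← ENNReal.rpow_inv_le_iff hp, ← one_div]
  exact le_iSup₂_of_le ℓ hℓ (le_iSup₂_of_le (f := fun (S : Set (Set (EuclideanSpace ℝ (Fin n))))
    (_ : S ∈ congruentCollections n ℓ) =>
    (∑' Q : S, volume (Q : Set (EuclideanSpace ℝ (Fin n))) * Φ Q ^ p) ^ (1 / p)) S hS le_rfl)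

theorem volume_mul_rpow_le_congruentSup (hp : 0 < p) {ℓ : ℝ} (hℓ : 0 < ℓ)
    {Q : Set (EuclideanSpace ℝ (Fin n))} (hQ : IsCube ℓ Q) :
    volume Q * Φ Q ^ p ≤ congruentSup p Φ ^ p := by
  have hS : {Q} ∈ congruentCollections n ℓ := ⟨by simpa using hQ, by simp⟩
  have h := tsum_le_congruentSup_rpow (Φ := Φ) hp hℓ hS
  rwa [tsum_singleton (f := fun Q => volume Q * Φ Q ^ p)] at h

theorem congruentSup_lt_top_of_le (hp : 0 < p) {C : ℝ≥0∞} (hC : C ≠ ∞)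
    (h : ∀ ℓ : ℝ, 0 < ℓ → ∀ Q, IsCube ℓ Q → Φ Q ≤ C * Ψ Q) (hΨ : congruentSup p Ψ < ∞) :
    congruentSup p Φ < ∞ := by
  refine congruentSup_lt_top hp (C := C ^ p * congruentSup p Ψ ^ p) ?_ fun ℓ hℓ S hS => ?_
  · exact ENNReal.mul_ne_top (ENNReal.rpow_ne_top_of_nonneg hp.le hC)
      (ENNReal.rpow_ne_top_of_nonneg hp.le hΨ.ne)
  · refine le_trans ?_ (mul_le_mul_right (tsum_le_congruentSup_rpow hp hℓ hS) _)
    rw [← ENNReal.tsum_mul_left]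
    refine ENNReal.tsum_le_tsum fun Q => ?_
    rw [mul_left_comm, ← ENNReal.mul_rpow_of_nonneg _ _ hp.le]
    gcongr
    exact h ℓ hℓ Q (hS.1 Q Q.2)

end CongruentSup

/-! ### Double integrals and the third-point comparison -/

section Energy

variable {𝕜 : Type*} [RCLike 𝕜] {n : ℕ}

/-- The double integral `∫_A ∫_B |f(x) - f(y)|^q / |x - y|^β dy dx`. -/
noncomputable def energy (q β : ℝ) (f : EuclideanSpace ℝ (Fin n) → 𝕜)
    (A B : Set (EuclideanSpace ℝ (Fin n))) : ℝ≥0∞ :=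
  ∫⁻ x in A, ∫⁻ y in B, ‖f x - f y‖ₑ ^ q / ‖x - y‖ₑ ^ β

variable {q β : ℝ} {f g : EuclideanSpace ℝ (Fin n) → 𝕜} {A B Q : Set (EuclideanSpace ℝ (Fin n))}

theorem phi_eq (q α : ℝ) (f : EuclideanSpace ℝ (Fin n) → 𝕜)
    (Q : Set (EuclideanSpace ℝ (Fin n))) :
    phi q α f Q = (volume Q ^ (q * α / n - 1) * energy q (n + q * α) f Q Q) ^ (1 / q) := rfl

theorem energy_zero : energy q 0 f A B = ∫⁻ x in A, ∫⁻ y in B, ‖f x - f y‖ₑ ^ q := by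
  simp [energy]

theorem energy_mono {A' B' : Set (EuclideanSpace ℝ (Fin n))} (hA : A ⊆ A') (hB : B ⊆ B') :
    energy q β f A B ≤ energy q β f A' B' :=
  (lintegral_mono_set hA).trans (lintegral_mono fun _ => lintegral_mono_set hB)

theorem energy_congr_ae (h : f =ᵐ[volume] g) (A B : Set (EuclideanSpace ℝ (Fin n))) :
    energy q β f A B = energy q β g A B := by
  refine lintegral_congr_ae (ae_restrict_of_ae ?_)
  filter_upwards [h] with x hx
  refine lintegral_congr_ae (ae_restrict_of_ae ?_)
  filter_upwards [h] with y hy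
  rw [hx, hy]

theorem phi_congr_ae {α : ℝ} (h : f =ᵐ[volume] g) (Q : Set (EuclideanSpace ℝ (Fin n))) :
    phi q α f Q = phi q α g Q := by
  rw [phi_eq, phi_eq, energy_congr_ae h]

theorem meanOsc_congr_ae (h : f =ᵐ[volume] g) (Q : Set (EuclideanSpace ℝ (Fin n))) :
    meanOsc q f Q = meanOsc q g Q := by
  have h1 : ⨍ y in Q, f y = ⨍ y in Q, g y :=
    average_congr (ae_restrict_of_ae h)
  unfold meanOsc
  rw [h1]
  congr 2
  refine lintegral_congr_ae (ae_restrict_of_ae ?_)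
  filter_upwards [h] with x hx
  rw [hx]

theorem measurable_energy_integrand (hf : Measurable f) (q β : ℝ) :
    Measurable fun z : EuclideanSpace ℝ (Fin n) × EuclideanSpace ℝ (Fin n) =>
      ‖f z.1 - f z.2‖ₑ ^ q / ‖z.1 - z.2‖ₑ ^ β := by
  fun_prop

theorem enorm_sub_rpow_le (hq : 1 ≤ q) (a b c : 𝕜) :
    ‖a - b‖ₑ ^ q ≤ 2 ^ (q - 1) * (‖a - c‖ₑ ^ q + ‖b - c‖ₑ ^ q) := by
  refine le_trans ?_ (ENNReal.rpow_add_le_mul_rpow_add_rpow _ _ hq)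
  refine ENNReal.rpow_le_rpow ?_ (by linarith)
  rw [show a - b = (a - c) - (b - c) by ring]
  exact enorm_sub_le

theorem lintegral_lintegral_add_self {g : EuclideanSpace ℝ (Fin n) → ℝ≥0∞} (hg : Measurable g)
    (A : Set (EuclideanSpace ℝ (Fin n))) :
    ∫⁻ x in A, ∫⁻ y in A, (g x + g y) = 2 * volume A * ∫⁻ x in A, g x := by
  have h : ∀ x, ∫⁻ y in A, (g x + g y) = g x * volume A + ∫⁻ y in A, g y := fun x => by
    rw [lintegral_add_left measurable_const]
    simp
  simp_rw [h]
  rw [lintegral_add_left (hg.mul_const _), lintegral_mul_const _ hg]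
  simp only [lintegral_const, MeasurableSet.univ, Measure.restrict_apply, univ_inter]
  ring

theorem mul_energy_zero_le_of_forall_le (hf : Measurable f) {V c : ℝ≥0∞}
    {g : EuclideanSpace ℝ (Fin n) → ℝ≥0∞} (hg : Measurable g)
    (h : ∀ᵐ x ∂volume.restrict A, ∀ᵐ y ∂volume.restrict A,
      V * ‖f x - f y‖ₑ ^ q ≤ c * (g x + g y)) :
    V * energy q 0 f A A ≤ c * (2 * volume A * ∫⁻ x in A, g x) := by
  have hm : Measurable fun z : EuclideanSpace ℝ (Fin n) × EuclideanSpace ℝ (Fin n) =>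
      ‖f z.1 - f z.2‖ₑ ^ q := by fun_prop
  have h2 : Measurable fun z : EuclideanSpace ℝ (Fin n) × EuclideanSpace ℝ (Fin n) =>
      g z.1 + g z.2 := by fun_prop
  rw [energy_zero, ← lintegral_lintegral_add_self hg]
  calc V * ∫⁻ x in A, ∫⁻ y in A, ‖f x - f y‖ₑ ^ q
      = ∫⁻ x in A, ∫⁻ y in A, V * ‖f x - f y‖ₑ ^ q := by
        rw [← lintegral_const_mul _ hm.lintegral_prod_right']
        refine lintegral_congr fun x => ?_
        rw [lintegral_const_mul _ (by fun_prop)]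
    _ ≤ ∫⁻ x in A, ∫⁻ y in A, c * (g x + g y) := by
        refine lintegral_mono_ae ?_
        filter_upwards [h] with x hx
        exact lintegral_mono_ae hx
    _ = c * ∫⁻ x in A, ∫⁻ y in A, (g x + g y) := by
        rw [← lintegral_const_mul _ h2.lintegral_prod_right']
        refine lintegral_congr fun x => ?_
        rw [lintegral_const_mul _ (by fun_prop)]

/-- Insert a third point z between x and y and integrate over z in B. It controls the oscillation on
a small set by its interaction with a large or distant one. -/
theorem volume_mul_energy_le (hq : 1 ≤ q) (hf : Measurable f) :
    volume B * energy q 0 f A A ≤ 2 ^ (q - 1) * (2 * volume A * energy q 0 f A B) := by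
  have hm : Measurable fun z : EuclideanSpace ℝ (Fin n) × EuclideanSpace ℝ (Fin n) =>
      ‖f z.1 - f z.2‖ₑ ^ q := by fun_prop
  have hg : Measurable fun x => ∫⁻ z in B, ‖f x - f z‖ₑ ^ q := hm.lintegral_prod_right'
  rw [energy_zero (B := B)]
  refine mul_energy_zero_le_of_forall_le hf hg (.of_forall fun x => .of_forall fun y => ?_)
  calc volume B * ‖f x - f y‖ₑ ^ q = ∫⁻ z in B, ‖f x - f y‖ₑ ^ q := by simp [mul_comm]
    _ ≤ ∫⁻ z in B, 2 ^ (q - 1) * (‖f x - f z‖ₑ ^ q + ‖f y - f z‖ₑ ^ q) :=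
        lintegral_mono fun z => enorm_sub_rpow_le hq _ _ _
    _ = _ := by
        rw [lintegral_const_mul _ (by fun_prop), lintegral_add_left (by fun_prop)]

/-- The power is monotone or antitone according to the sign of β, so one endpoint always dominates;
adding both avoids a case distinction later. -/
theorem rpow_le_rpow_add_rpow {a b t : ℝ≥0∞} (ha : a ≤ t) (hb : t ≤ b) (β : ℝ) :
    t ^ β ≤ a ^ β + b ^ β := by
  rcases le_total 0 β with h | h
  · exact (ENNReal.rpow_le_rpow hb h).trans le_add_self
  · refine le_trans ?_ le_self_add
    rw [← neg_neg β, ENNReal.rpow_neg t, ENNReal.rpow_neg a, ENNReal.inv_le_inv]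
    exact ENNReal.rpow_le_rpow ha (by linarith)

theorem volume_ball_le (x : EuclideanSpace ℝ (Fin n)) (r : ℝ) :
    volume (Metric.ball x r) ≤ ENNReal.ofReal (2 * r) ^ n := by
  rw [← sub_zero x, ← volume_centeredCube, ← measure_preimage_add _ x]
  refine measure_mono fun y hy => mem_centeredCube ?_
  simpa [dist_eq_norm] using hy

/-- Each ball lies in a cube of edge ℓ/4, of volume 4^{-n}|Q| ≤ |Q|/4, so the two balls remove at
most half of Q. -/
theorem IsCube.volume_le_two_mul_sdiff (hn : 1 ≤ n) {ℓ : ℝ} (hℓ : 0 < ℓ) (hQ : IsCube ℓ Q)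
    (x y : EuclideanSpace ℝ (Fin n)) :
    volume Q ≤ 2 * volume (Q \ (Metric.ball x (ℓ / 8) ∪ Metric.ball y (ℓ / 8))) := by
  set U := Metric.ball x (ℓ / 8) ∪ Metric.ball y (ℓ / 8)
  have h1 : volume U ≤ volume Q / 2 := by
    have h2 : ENNReal.ofReal (2 * (ℓ / 8)) ^ n ≤ volume Q / 4 := by
      rw [hQ.volume_eq, ← ENNReal.ofReal_pow (by positivity), ← ENNReal.ofReal_pow hℓ.le,
        show (4 : ℝ≥0∞) = ENNReal.ofReal 4 by simp, ← ENNReal.ofReal_div_of_pos (by norm_num)]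
      refine ENNReal.ofReal_le_ofReal ?_
      rw [show 2 * (ℓ / 8) = ℓ * (1 / 4) by ring, mul_pow, div_eq_mul_one_div]
      refine mul_le_mul_of_nonneg_left ?_ (by positivity)
      simpa using pow_le_pow_of_le_one (by norm_num : (0 : ℝ) ≤ 1 / 4) (by norm_num) hn
    calc volume U ≤ volume Q / 4 + volume Q / 4 :=
          (measure_union_le _ _).trans (add_le_add ((volume_ball_le _ _).trans h2)
            ((volume_ball_le _ _).trans h2))
      _ = volume Q / 2 := by
          rw [← two_mul, div_eq_mul_inv, div_eq_mul_inv, mul_left_comm,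
            show (4 : ℝ≥0∞) = 2 * 2 by norm_num, ENNReal.mul_inv (by simp) (by simp),
            ← mul_assoc 2, ENNReal.mul_inv_cancel (by simp) (by simp), one_mul]
  have h3 : volume Q / 2 + volume Q / 2 ≤ volume (Q \ U) + volume Q / 2 := by
    rw [ENNReal.add_halves]
    calc volume Q ≤ volume (Q \ U ∪ U) := measure_mono (by simp)
      _ ≤ volume (Q \ U) + volume Q / 2 := (measure_union_le _ _).trans (by gcongr)
  have h4 := ENNReal.le_of_add_le_add_right
    (ENNReal.div_ne_top hQ.volume_ne_top (by simp)) h3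
  calc volume Q = 2 * (volume Q / 2) := (ENNReal.mul_div_cancel (by simp) (by simp)).symm
    _ ≤ _ := by gcongr

/-- For β < 0 the kernel |x-y|^{-β} vanishes on the diagonal, so no pointwise comparison is
possible. Instead x and y are compared through points z at distance at least ℓ/8 from both, where
the kernel is comparable to ℓ^{-β}; such z fill at least half of Q. -/
theorem exists_energy_zero_le (hn : 1 ≤ n) (hq : 1 ≤ q) (β : ℝ) :
    ∃ C : ℝ≥0∞, C ≠ ∞ ∧ ∀ f : EuclideanSpace ℝ (Fin n) → 𝕜, Measurable f →
      ∀ ℓ : ℝ, 0 < ℓ → ∀ Q, IsCube ℓ Q →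
        energy q 0 f Q Q ≤ C * ENNReal.ofReal ℓ ^ β * energy q β f Q Q := by
  have hn' : 0 < √(n : ℝ) := Real.sqrt_pos.2 (by exact_mod_cast hn)
  -- The two powers come from the range 1/8 ≤ |x-z|/ℓ ≤ √n, the first 2 from discarding half of Q,
  -- the last 2 from the symmetric roles of x and y.
  refine ⟨2 * 2 ^ (q - 1) * (ENNReal.ofReal (1 / 8) ^ β + ENNReal.ofReal (√n) ^ β) * 2, ?_,
    fun f hf ℓ hℓ Q hQ => ?_⟩
  · have h1 : ENNReal.ofReal (1 / 8) ^ β ≠ ∞ :=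
      ENNReal.rpow_ne_top_of_ne_zero (by simp) (by simp)
    have h2 : ENNReal.ofReal (√n) ^ β ≠ ∞ :=
      ENNReal.rpow_ne_top_of_ne_zero (by simpa using hn') (by simp)
    have h3 : (2 : ℝ≥0∞) ^ (q - 1) ≠ ∞ := ENNReal.rpow_ne_top_of_ne_zero (by simp) (by simp)
    finiteness
  set c : ℝ≥0∞ := ENNReal.ofReal (1 / 8) ^ β + ENNReal.ofReal (√n) ^ β
  set M : ℝ≥0∞ := c * ENNReal.ofReal ℓ ^ β with hM
  have hF := measurable_energy_integrand hf q β
  set F : EuclideanSpace ℝ (Fin n) → EuclideanSpace ℝ (Fin n) → ℝ≥0∞ :=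
    fun x y => ‖f x - f y‖ₑ ^ q / ‖x - y‖ₑ ^ β
  have hfar : ∀ x ∈ Q, ∀ z ∈ Q, z ∉ Metric.ball x (ℓ / 8) → ‖f x - f z‖ₑ ^ q ≤ M * F x z := by
    intro x hx z hz hxz
    have h1 : ENNReal.ofReal (ℓ / 8) ≤ ‖x - z‖ₑ := by
      rw [← ofReal_norm]
      refine ENNReal.ofReal_le_ofReal ?_
      simpa [dist_eq_norm, norm_sub_rev] using hxz
    have h0 : ‖x - z‖ₑ ≠ 0 := fun h => by
      rw [h] at h1
      simp only [nonpos_iff_eq_zero, ENNReal.ofReal_eq_zero] at h1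
      linarith
    have h2 : ‖x - z‖ₑ ^ β ≤ M := by
      refine (rpow_le_rpow_add_rpow h1 (hQ.enorm_sub_le hℓ hx hz) β).trans_eq ?_
      rw [hM, add_mul, ← ENNReal.mul_rpow_of_ne_top (by simp) (by simp),
        ← ENNReal.mul_rpow_of_ne_top (by simp) (by simp), ← ENNReal.ofReal_mul (by norm_num),
        ← ENNReal.ofReal_mul (by positivity)]
      congr 3
      ring
    calc ‖f x - f z‖ₑ ^ q = ‖x - z‖ₑ ^ β * F x z :=
          (ENNReal.mul_div_cancel (by simp [ENNReal.rpow_eq_zero_iff, h0])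
            (ENNReal.rpow_ne_top_of_ne_zero h0 (by simp))).symm
      _ ≤ M * F x z := by gcongr
  have hg : Measurable fun x => ∫⁻ z in Q, F x z := hF.lintegral_prod_right'
  have hFx : ∀ x, Measurable fun z => F x z := fun x => hF.comp measurable_prodMk_left
  have h1 : ∀ x ∈ Q, ∀ y ∈ Q, volume Q * ‖f x - f y‖ₑ ^ q ≤
      2 * 2 ^ (q - 1) * M * ((∫⁻ z in Q, F x z) + ∫⁻ z in Q, F y z) := fun x hx y hy => by
    set U := Metric.ball x (ℓ / 8) ∪ Metric.ball y (ℓ / 8)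
    have hU : NullMeasurableSet (Q \ U) volume :=
      hQ.nullMeasurableSet.diff
        (Metric.isOpen_ball.union Metric.isOpen_ball).nullMeasurableSet
    calc volume Q * ‖f x - f y‖ₑ ^ q ≤ 2 * volume (Q \ U) * ‖f x - f y‖ₑ ^ q :=
          mul_le_mul_left (hQ.volume_le_two_mul_sdiff hn hℓ x y) _
      _ = 2 * ∫⁻ z in Q \ U, ‖f x - f y‖ₑ ^ q := by
          rw [lintegral_const, Measure.restrict_apply_univ]
          ring
      _ ≤ 2 * ∫⁻ z in Q \ U, 2 ^ (q - 1) * M * (F x z + F y z) := by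
          refine mul_le_mul_right (lintegral_mono_ae ?_) _
          filter_upwards [ae_restrict_mem₀ hU] with z hz
          have hz2 := hz.2
          simp only [U, mem_union, not_or] at hz2
          refine (enorm_sub_rpow_le hq _ _ (f z)).trans ?_
          rw [mul_assoc, mul_add M]
          gcongr
          · exact hfar x hx z hz.1 hz2.1
          · exact hfar y hy z hz.1 hz2.2
      _ ≤ 2 * ∫⁻ z in Q, 2 ^ (q - 1) * M * (F x z + F y z) :=
          mul_le_mul_right (lintegral_mono_set sdiff_subset) _
      _ = _ := by
          rw [lintegral_const_mul _ (by fun_prop), lintegral_add_left (hFx x)]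
          ring
  have h2 : volume Q * energy q 0 f Q Q ≤ volume Q *
      (2 * 2 ^ (q - 1) * c * 2 * ENNReal.ofReal ℓ ^ β * energy q β f Q Q) := by
    refine (mul_energy_zero_le_of_forall_le (c := 2 * 2 ^ (q - 1) * M) hf hg ?_).trans_eq ?_
    · filter_upwards [ae_restrict_mem₀ hQ.nullMeasurableSet] with x hx
      filter_upwards [ae_restrict_mem₀ hQ.nullMeasurableSet] with y hy
      exact h1 x hx y hy
    · change _ = volume Q * (_ * ∫⁻ x in Q, ∫⁻ y in Q, F x y)
      rw [hM]
      ring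
  exact (ENNReal.mul_le_mul_iff_right (hQ.volume_ne_zero hℓ) hQ.volume_ne_top).1 h2

/-- One x valid for all the exhausting cubes at once supplies the constant f x. -/
theorem mem_aeConstants_of_energy_eq_zero (hq : 0 < q) (hf : Measurable f)
    (h : ∀ k : ℕ, energy q 0 f (centeredCube n k) (centeredCube n k) = 0) :
    f ∈ aeConstants 𝕜 n := by
  have h1 : ∀ᵐ x, ∀ k : ℕ, x ∈ centeredCube n k → ∀ᵐ y, y ∈ centeredCube n k → f y = f x := by
    rw [ae_all_iff]
    intro k
    have hk := h k
    have hm : Measurable fun z : EuclideanSpace ℝ (Fin n) × EuclideanSpace ℝ (Fin n) =>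
      ‖f z.1 - f z.2‖ₑ ^ q := by fun_prop
    rw [energy_zero, lintegral_eq_zero_iff hm.lintegral_prod_right', Filter.EventuallyEq,
      ae_restrict_iff' (isOpen_centeredCube _).measurableSet] at hk
    filter_upwards [hk] with x hx hxk
    have := hx hxk
    rw [Pi.zero_apply, lintegral_eq_zero_iff (by fun_prop), Filter.EventuallyEq,
      ae_restrict_iff' (isOpen_centeredCube _).measurableSet] at this
    filter_upwards [this] with y hy hyk
    have h2 := hy hyk
    simp only [Pi.zero_apply, ENNReal.rpow_eq_zero_iff, enorm_ne_top, false_and, or_false,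
      hq, and_true, enorm_eq_zero, sub_eq_zero] at h2
    exact h2.symm
  obtain ⟨x, hx⟩ := h1.exists
  refine ⟨f x, ?_⟩
  obtain ⟨N, hN⟩ := exists_nat_forall_mem_centeredCube x
  have h2 : ∀ᵐ y, ∀ k : ℕ, N ≤ k → y ∈ centeredCube n k → f y = f x := by
    rw [ae_all_iff]
    intro k
    by_cases hk : N ≤ k
    · filter_upwards [hx k (hN k hk)] with y hy _ using hy
    · exact Filter.Eventually.of_forall fun y hk' => absurd hk' hk
  filter_upwards [h2] with y hy
  obtain ⟨N', hN'⟩ := exists_nat_forall_mem_centeredCube y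
  exact hy (max N N') (le_max_left _ _) (hN' _ (le_max_right _ _))

theorem eq_zero_of_forall_le_mul_rpow {a C : ℝ≥0∞} (hC : C ≠ ∞) {s R₀ : ℝ} (hs : s < 0)
    (h : ∀ R : ℝ, R₀ ≤ R → 0 < R → a ≤ C * ENNReal.ofReal R ^ s) : a = 0 := by
  have h1 : Filter.Tendsto (fun R : ℝ => C * ENNReal.ofReal R ^ s) Filter.atTop (nhds 0) := by
    have h2 : Filter.Tendsto (fun R : ℝ => ENNReal.ofReal (R ^ s)) Filter.atTop (nhds 0) := by
      rw [← ENNReal.ofReal_zero]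
      refine ENNReal.tendsto_ofReal ?_
      simpa using tendsto_rpow_neg_atTop (y := -s) (by linarith)
    have h3 := ENNReal.Tendsto.const_mul h2 (Or.inr hC)
    rw [mul_zero] at h3
    refine h3.congr' ?_
    filter_upwards [Filter.eventually_gt_atTop 0] with R hR
    rw [ENNReal.ofReal_rpow_of_pos hR]
  refine nonpos_iff_eq_zero.1 (ge_of_tendsto h1 ?_)
  filter_upwards [Filter.eventually_ge_atTop R₀, Filter.eventually_gt_atTop 0] with R h2 h3
  exact h R h2 h3

end Energy

/-! ### Triviality from large cubes and from the critical case p = q, α = 0 -/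

section Constants

variable {𝕜 : Type*} [RCLike 𝕜] {n : ℕ} {p q α : ℝ}

theorem aeConstants_subset_JNQ (hp : 1 ≤ p) (hq : 1 ≤ q) :
    aeConstants 𝕜 n ⊆ JNQ 𝕜 n p q α := by
  rintro f ⟨c, hc⟩
  refine ⟨aestronglyMeasurable_const.congr hc.symm, ?_⟩
  refine congruentSup_lt_top (by linarith) ENNReal.zero_ne_top fun ℓ hℓ S hS => ?_
  have h0 : ∀ Q : Set (EuclideanSpace ℝ (Fin n)), phi q α f Q = 0 := fun Q => by
    have : (0 : ℝ) < q := by linarith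
    rw [phi_congr_ae hc, phi_eq]
    simp [energy, ENNReal.zero_rpow_of_pos this, this]
  simp [h0, ENNReal.zero_rpow_of_pos (by linarith : 0 < p)]

theorem exists_measurable_of_mem_JNQ {f : EuclideanSpace ℝ (Fin n) → 𝕜}
    (hf : f ∈ JNQ 𝕜 n p q α) : ∃ g : EuclideanSpace ℝ (Fin n) → 𝕜, Measurable g ∧
      f =ᵐ[volume] g ∧ congruentSup p (phi q α g) < ∞ := by
  obtain ⟨h1, h2⟩ := hf
  refine ⟨h1.mk f, h1.stronglyMeasurable_mk.measurable, h1.ae_eq_mk, ?_⟩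
  rwa [show phi q α (h1.mk f) = phi q α f from
    funext fun Q => (phi_congr_ae h1.ae_eq_mk Q).symm]

theorem JNQ_eq_aeConstants_of_forall_mem (hp : 1 ≤ p) (hq : 1 ≤ q)
    (h : ∀ f : EuclideanSpace ℝ (Fin n) → 𝕜, Measurable f → congruentSup p (phi q α f) < ∞ →
      f ∈ aeConstants 𝕜 n) :
    JNQ 𝕜 n p q α = aeConstants 𝕜 n := by
  refine Subset.antisymm (fun f hf => ?_) (aeConstants_subset_JNQ hp hq)
  obtain ⟨g, hg, hfg, hgs⟩ := exists_measurable_of_mem_JNQ hf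
  obtain ⟨c, hc⟩ := h g hg hgs
  exact ⟨c, hfg.trans hc⟩

theorem JNQ_eq_aeConstants (hp : 1 ≤ p) (hq : 1 ≤ q)
    (h : ∀ f : EuclideanSpace ℝ (Fin n) → 𝕜, Measurable f → congruentSup p (phi q α f) < ∞ →
      ∀ k : ℕ, energy q 0 f (centeredCube n k) (centeredCube n k) = 0) :
    JNQ 𝕜 n p q α = aeConstants 𝕜 n := by
  exact JNQ_eq_aeConstants_of_forall_mem hp hq fun f hf hfs =>
    mem_aeConstants_of_energy_eq_zero (by linarith) hf (h f hf hfs)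

/-- A single cube is an admissible collection; the exponent of ℓ is q(α₀ - α), whose sign decides
whether large cubes force the energy to vanish. -/
theorem energy_le_congruentSup (hn : 1 ≤ n) (hp : 1 ≤ p) (hq : 1 ≤ q)
    (f : EuclideanSpace ℝ (Fin n) → 𝕜) {ℓ : ℝ} (hℓ : 0 < ℓ)
    {Q : Set (EuclideanSpace ℝ (Fin n))} (hQ : IsCube ℓ Q) :
    energy q (n + q * α) f Q Q ≤ congruentSup p (phi q α f) ^ q *
      ENNReal.ofReal ℓ ^ (q * (n * (1 / q - 1 / p) - α)) := by
  have hp0 : 0 < p := by linarith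
  have hq0 : 0 < q := by linarith
  have hn0 : (n : ℝ) ≠ 0 := by positivity
  have hL0 : ENNReal.ofReal ℓ ≠ 0 := by simpa using hℓ
  have hLt : ENNReal.ofReal ℓ ≠ ∞ := by simp
  set L := ENNReal.ofReal ℓ
  set K := congruentSup p (phi q α f)
  set s := q * (n * (1 / q - 1 / p) - α) with hs
  have h1 := volume_mul_rpow_le_congruentSup (Φ := phi q α f) hp0 hℓ hQ
  have h2 : L ^ (n / p : ℝ) * phi q α f Q ≤ K := by
    rw [← ENNReal.rpow_le_rpow_iff hp0, ENNReal.mul_rpow_of_nonneg _ _ hp0.le,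
      ← ENNReal.rpow_mul, div_mul_cancel₀ _ hp0.ne', ← hQ.volume_eq_rpow]
    exact h1
  have h3 : L ^ (-s) * energy q (n + q * α) f Q Q ≤ K ^ q := by
    refine le_trans (le_of_eq ?_) (ENNReal.rpow_le_rpow h2 hq0.le)
    rw [phi_eq, ENNReal.mul_rpow_of_nonneg _ _ hq0.le, ← ENNReal.rpow_mul, ← ENNReal.rpow_mul,
      one_div_mul_cancel hq0.ne', ENNReal.rpow_one, hQ.volume_eq_rpow, ← ENNReal.rpow_mul,
      ← mul_assoc, ← ENNReal.rpow_add _ _ hL0 hLt]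
    congr 2
    rw [hs]
    field_simp
    ring
  calc energy q (n + q * α) f Q Q = L ^ s * (L ^ (-s) * energy q (n + q * α) f Q Q) := by
        rw [← mul_assoc, ← ENNReal.rpow_add _ _ hL0 hLt, add_neg_cancel, ENNReal.rpow_zero,
          one_mul]
    _ ≤ L ^ s * K ^ q := by gcongr
    _ = K ^ q * L ^ s := mul_comm _ _

theorem JNQ_eq_aeConstants_of_lt (hn : 1 ≤ n) (hp : 1 ≤ p) (hq : 1 ≤ q)
    (hα : n * (1 / q - 1 / p) < α) : JNQ 𝕜 n p q α = aeConstants 𝕜 n := by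
  refine JNQ_eq_aeConstants hp hq fun f hf hK k => ?_
  obtain ⟨C, -, hC⟩ := exists_energy_zero_le (𝕜 := 𝕜) hn hq (n + q * α)
  -- For k = 0 the cube is empty, and the comparison `hC` requires a positive edge length.
  rcases Nat.eq_zero_or_pos k with rfl | hk
  · simp [energy, Measure.restrict_eq_zero.2
      (show volume (centeredCube n 0) = 0 by rw [volume_centeredCube]; simp; omega)]
  have hk' : (0 : ℝ) < k := by exact_mod_cast hk
  have h0 : energy q (n + q * α) f (centeredCube n k) (centeredCube n k) = 0 := by
    refine eq_zero_of_forall_le_mul_rpow (C := congruentSup p (phi q α f) ^ q) (R₀ := 2 * k)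
      (s := q * (n * (1 / q - 1 / p) - α)) ?_ ?_ fun R hR hR0 => ?_
    · exact ENNReal.rpow_ne_top_of_nonneg (by linarith) hK.ne
    · exact mul_neg_of_pos_of_neg (by linarith) (by linarith)
    · have hsub : centeredCube n k ⊆ centeredCube n (R / 2) := centeredCube_mono (by linarith)
      refine (energy_mono hsub hsub).trans ?_
      have hc := isCube_centeredCube (n := n) (R / 2)
      rw [show 2 * (R / 2) = R by ring] at hc
      exact energy_le_congruentSup hn hp hq f hR0 hc
  have h1 := hC f hf (2 * k) (by linarith) _ (isCube_centeredCube _)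
  rw [h0, mul_zero] at h1
  exact nonpos_iff_eq_zero.1 h1

/-- With A fixed and Q of edge R, the third-point bound gives |Q| E(A,A) ≲ |A| E(Q,Q) ≲ |A|
R^{n+qα₀} for the unweighted energy E. The parameter α cancels, and dividing by |Q| = R^n leaves
R^{qα₀} → 0. -/
theorem JNQ_eq_aeConstants_of_neg (hn : 1 ≤ n) (hp : 1 ≤ p) (hq : 1 ≤ q)
    (hα₀ : n * (1 / q - 1 / p) < 0) : JNQ 𝕜 n p q α = aeConstants 𝕜 n := by
  refine JNQ_eq_aeConstants hp hq fun f hf hK k => ?_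
  obtain ⟨C, hCt, hC⟩ := exists_energy_zero_le (𝕜 := 𝕜) hn hq (n + q * α)
  set K := congruentSup p (phi q α f)
  have hKt : K ^ q ≠ ∞ := ENNReal.rpow_ne_top_of_nonneg (by linarith) hK.ne
  set V := volume (centeredCube n k) with hV
  have hVt : V ≠ ∞ := (isCube_centeredCube _).volume_ne_top
  refine eq_zero_of_forall_le_mul_rpow (C := 2 ^ (q - 1) * (2 * V) * C * K ^ q) (R₀ := 2 * k)
      (s := q * (n * (1 / q - 1 / p))) ?_ ?_ fun R hR hR0 => ?_
  · have h3 : (2 : ℝ≥0∞) ^ (q - 1) ≠ ∞ := ENNReal.rpow_ne_top_of_ne_zero (by simp) (by simp)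
    finiteness
  · exact mul_neg_of_pos_of_neg (by linarith) (by linarith)
  · have hsub : centeredCube n k ⊆ centeredCube n (R / 2) := centeredCube_mono (by linarith)
    have hc := isCube_centeredCube (n := n) (R / 2)
    rw [show 2 * (R / 2) = R by ring] at hc
    set Q := centeredCube n (R / 2)
    set L := ENNReal.ofReal R with hL
    have hL0 : L ≠ 0 := by simpa [hL] using hR0
    have hLt : L ≠ ∞ := by simp [hL]
    have h1 := energy_le_congruentSup (α := α) hn hp hq f hR0 hc
    have h2 := hC f hf R hR0 _ hc
    have h3 := volume_mul_energy_le (A := centeredCube n k) (B := Q) hq hf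
    have h4 : volume Q * energy q 0 f (centeredCube n k) (centeredCube n k) ≤
        volume Q * (2 ^ (q - 1) * (2 * V) * C * K ^ q * L ^ (q * (n * (1 / q - 1 / p)))) := by
      calc volume Q * energy q 0 f (centeredCube n k) (centeredCube n k)
          ≤ 2 ^ (q - 1) * (2 * V * energy q 0 f Q Q) :=
            h3.trans (by gcongr; exact energy_mono hsub subset_rfl)
        _ ≤ 2 ^ (q - 1) * (2 * V * (C * L ^ (n + q * α) *
              (K ^ q * L ^ (q * (n * (1 / q - 1 / p) - α))))) := by gcongr; exact h2.trans (by gcongr)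
        _ = 2 ^ (q - 1) * (2 * V) * C * K ^ q * (L ^ (n + q * α) *
              L ^ (q * (n * (1 / q - 1 / p) - α))) := by ring
        _ = 2 ^ (q - 1) * (2 * V) * C * K ^ q * (L ^ (n : ℝ) *
              L ^ (q * (n * (1 / q - 1 / p)))) := by
            rw [← ENNReal.rpow_add _ _ hL0 hLt, ← ENNReal.rpow_add _ _ hL0 hLt]
            congr 2
            ring
        _ = _ := by
            rw [hc.volume_eq_rpow]
            ring
    exact (ENNReal.mul_le_mul_iff_right (hc.volume_ne_zero hR0) hc.volume_ne_top).1 h4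

theorem eq_zero_of_forall_nat_mul_le {a C : ℝ≥0∞} (hC : C ≠ ∞) (h : ∀ N : ℕ, N * a ≤ C) :
    a = 0 := by
  by_contra ha
  obtain ⟨N, hN⟩ := ENNReal.exists_nat_mul_gt ha hC
  exact absurd (h N) (not_le.2 hN)

theorem energy_inter_add_sdiff {f : EuclideanSpace ℝ (Fin n) → 𝕜} (hf : Measurable f) {β : ℝ}
    {A B B' : Set (EuclideanSpace ℝ (Fin n))} (hB' : MeasurableSet B') (h : B' ⊆ B) :
    energy q β f A B = energy q β f A B' + energy q β f A (B \ B') := by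
  have hF := measurable_energy_integrand hf q β
  have h1 : Measurable fun x => ∫⁻ y in B', ‖f x - f y‖ₑ ^ q / ‖x - y‖ₑ ^ β :=
    hF.lintegral_prod_right'
  unfold energy
  rw [← lintegral_add_left h1]
  refine lintegral_congr fun x => ?_
  rw [← lintegral_inter_add_sdiff _ B hB', inter_eq_self_of_subset_right h]

/-- On pairs at distance at most D, |x-y|^{-β} ≤ D^{γ-β} |x-y|^{-γ}; on the diagonal the numerator
vanishes because q > 0. -/
theorem energy_le_mul_energy (f : EuclideanSpace ℝ (Fin n) → 𝕜) {β γ : ℝ} (hq : 0 < q)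
    (hβ : β ≤ γ) {D : ℝ≥0∞} {A B : Set (EuclideanSpace ℝ (Fin n))} (hDt : D ≠ ∞)
    (hA : NullMeasurableSet A) (hB : NullMeasurableSet B)
    (hD : ∀ x ∈ A, ∀ y ∈ B, ‖x - y‖ₑ ≤ D) :
    energy q β f A B ≤ D ^ (γ - β) * energy q γ f A B := by
  have hDt' : D ^ (γ - β) ≠ ∞ := ENNReal.rpow_ne_top_of_nonneg (by linarith) hDt
  unfold energy
  rw [← lintegral_const_mul' _ _ hDt']
  refine lintegral_mono_ae ?_
  filter_upwards [ae_restrict_mem₀ hA] with x hx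
  rw [← lintegral_const_mul' _ _ hDt']
  refine lintegral_mono_ae ?_
  filter_upwards [ae_restrict_mem₀ hB] with y hy
  rcases eq_or_ne x y with rfl | hxy
  · simp [ENNReal.zero_rpow_of_pos hq]
  · have h0 : ‖x - y‖ₑ ≠ 0 := by simpa [sub_eq_zero] using hxy
    have ht : ‖x - y‖ₑ ≠ ∞ := enorm_ne_top
    calc ‖f x - f y‖ₑ ^ q / ‖x - y‖ₑ ^ β
        = ‖x - y‖ₑ ^ (γ - β) * (‖f x - f y‖ₑ ^ q / ‖x - y‖ₑ ^ γ) := by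
          rw [div_eq_mul_inv, div_eq_mul_inv, ← ENNReal.rpow_neg, ← ENNReal.rpow_neg,
            mul_left_comm, ← ENNReal.rpow_add _ _ h0 ht]
          congr 2
          ring
      _ ≤ _ := by
          refine mul_le_mul_left (ENNReal.rpow_le_rpow (hD x hx y hy) (by linarith)) _

/-- Here the energy bound does not depend on the size of the cube. On a dyadic annulus of radius R
the kernel is at least of order R^{-n} and the volume of order R^n, so every scale contributes the
same amount and N scales give N · E(A,A) ≤ c K^p, with E the unweighted energy. -/
theorem JNQ_zero_eq_aeConstants (hn : 1 ≤ n) (hp : 1 ≤ p) :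
    JNQ 𝕜 n p p 0 = aeConstants 𝕜 n := by
  refine JNQ_eq_aeConstants hp hp fun f hf hK k => ?_
  set K := congruentSup p (phi p 0 f)
  have hKt : K ^ p ≠ ∞ := ENNReal.rpow_ne_top_of_nonneg (by linarith) hK.ne
  have hbound : ∀ R : ℝ, 0 < R →
      energy p n f (centeredCube n R) (centeredCube n R) ≤ K ^ p := fun R hR => by
    have h := energy_le_congruentSup (α := 0) hn hp hp f (by linarith : 0 < 2 * R)
      (isCube_centeredCube R)
    simpa using h
  -- The shift by 1 keeps the starting cube nondegenerate when k = 0.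
  set r : ℝ := k + 1 with hr
  have hr0 : 0 < r := by positivity
  set A := centeredCube n r with hA
  refine nonpos_iff_eq_zero.1 ((energy_mono (centeredCube_mono (by linarith))
    (centeredCube_mono (by linarith))).trans (b := energy p 0 f A A) (le_of_eq ?_))
  -- The leading 2 is from |B| ≤ 2|B \ B'|, the middle factors from the third-point bound, and √n^n
  -- is the ratio diam(B)^n / |B|, so c is independent of the scale.
  set c : ℝ≥0∞ := 2 * (2 ^ (p - 1) * (2 * volume A * ENNReal.ofReal √n ^ (n : ℝ))) with hc
  have hct : c ≠ ∞ := by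
    have h3 : (2 : ℝ≥0∞) ^ (p - 1) ≠ ∞ := ENNReal.rpow_ne_top_of_ne_zero (by simp) (by simp)
    have h4 : volume A ≠ ∞ := (isCube_centeredCube _).volume_ne_top
    finiteness
  have hstep : ∀ j : ℕ, energy p 0 f A A ≤ c * energy p n f A
      (centeredCube n (2 ^ (j + 1) * r) \ centeredCube n (2 ^ j * r)) := fun j => by
    set R := 2 ^ j * r with hR
    have hR0 : 0 < R := by positivity
    have hR1 : r ≤ R := le_mul_of_one_le_left hr0.le (one_le_pow₀ (by norm_num))
    rw [show (2 : ℝ) ^ (j + 1) * r = 2 * R by rw [hR]; ring]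
    set B := centeredCube n (2 * R)
    set B' := centeredCube n R
    have hB : volume B ≤ 2 * volume (B \ B') := by
      have hR' : volume B = ENNReal.ofReal (2 * (2 * R)) ^ n := volume_centeredCube _
      have h1 : 2 * volume B' ≤ volume B := by
        rw [hR', volume_centeredCube, ENNReal.ofReal_mul (by norm_num) (q := 2 * R), mul_pow]
        gcongr
        simpa using pow_le_pow_right₀ (by norm_num : (1 : ℝ≥0∞) ≤ 2) hn
      have h2 : volume B ≤ volume (B \ B') + volume B' :=
        (measure_mono (by simp)).trans (measure_union_le (B \ B') B')
      refine ENNReal.le_of_add_le_add_right (isCube_centeredCube (n := n) (2 * R)).volume_ne_top ?_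
      calc volume B + volume B = 2 * volume B := (two_mul _).symm
        _ ≤ 2 * volume (B \ B') + 2 * volume B' := by
            rw [← mul_add]
            gcongr
        _ ≤ 2 * volume (B \ B') + volume B := by gcongr
    have h1 := volume_mul_energy_le (A := A) (B := B \ B') hp hf
    have hAB : A ⊆ B := centeredCube_mono (by linarith)
    have hcB : IsCube (2 * (2 * R)) B := isCube_centeredCube _
    have h2 := energy_le_mul_energy f (q := p) (β := 0) (γ := n) (A := A) (B := B \ B')
      (D := ENNReal.ofReal (√n * (2 * (2 * R)))) (by linarith) (by positivity)
      ENNReal.ofReal_ne_top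
      (isOpen_centeredCube _).nullMeasurableSet
      ((isOpen_centeredCube _).measurableSet.diff
        (isOpen_centeredCube _).measurableSet).nullMeasurableSet
      fun x hx y hy => hcB.enorm_sub_le (by positivity) (hAB hx) hy.1
    have h3 : volume B * energy p 0 f A A ≤ volume B * (c * energy p n f A (B \ B')) := by
      calc volume B * energy p 0 f A A ≤ 2 * volume (B \ B') * energy p 0 f A A := by gcongr
        _ = 2 * (volume (B \ B') * energy p 0 f A A) := mul_assoc _ _ _
        _ ≤ 2 * (2 ^ (p - 1) * (2 * volume A * energy p 0 f A (B \ B'))) := by gcongr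
        _ ≤ 2 * (2 ^ (p - 1) * (2 * volume A * (ENNReal.ofReal (√n * (2 * (2 * R))) ^ (n - 0 : ℝ) *
              energy p n f A (B \ B')))) := by gcongr
        _ = _ := by
          rw [hcB.volume_eq_rpow, sub_zero, ENNReal.ofReal_mul (by positivity),
            ENNReal.mul_rpow_of_nonneg _ _ (by positivity), hc]
          ring
    exact (ENNReal.mul_le_mul_iff_right ((isCube_centeredCube _).volume_ne_zero (by positivity))
      (isCube_centeredCube _).volume_ne_top).1 h3
  have hsum : ∀ N : ℕ, N * energy p 0 f A A ≤ c * energy p n f A (centeredCube n (2 ^ N * r)) := by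
    intro N
    induction N with
    | zero => simp
    | succ N ih =>
      rw [energy_inter_add_sdiff (B := centeredCube n (2 ^ (N + 1) * r)) hf
        (isOpen_centeredCube (2 ^ N * r)).measurableSet
        (centeredCube_mono (by rw [pow_succ]; nlinarith [pow_pos (two_pos (α := ℝ)) N])), mul_add]
      push_cast
      rw [add_mul, one_mul]
      exact add_le_add ih (hstep N)
  refine eq_zero_of_forall_nat_mul_le (C := c * K ^ p) (by finiteness) fun N => ?_
  refine (hsum N).trans ?_
  gcongr
  refine (energy_mono (centeredCube_mono ?_) subset_rfl).trans (hbound _ (by positivity))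
  exact le_mul_of_one_le_left hr0.le (one_le_pow₀ (by norm_num))

end Constants

/-! ### Triviality for α ≥ 1 by subdividing increments -/

section Translations

variable {𝕜 : Type*} [RCLike 𝕜] {n : ℕ} {p q α : ℝ} {f : EuclideanSpace ℝ (Fin n) → 𝕜}

theorem lintegral_comp_inv_smul (φ : EuclideanSpace ℝ (Fin n) → ℝ≥0∞) {m : ℝ} (hm : 0 < m) :
    ∫⁻ x, φ (m⁻¹ • x) = ENNReal.ofReal m ^ n * ∫⁻ x, φ x := by
  have h := lintegral_map_equiv (μ := (volume : Measure (EuclideanSpace ℝ (Fin n)))) φ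
    (MeasurableEquiv.smul₀ m⁻¹ (inv_ne_zero hm.ne'))
  simp only [MeasurableEquiv.coe_smul₀] at h
  rw [← h, Measure.map_addHaar_smul _ (inv_ne_zero hm.ne'), lintegral_smul_measure, inv_pow,
    inv_inv, finrank_euclideanSpace_fin, abs_of_pos (pow_pos hm _), ENNReal.ofReal_pow hm.le,
    smul_eq_mul]

theorem setLIntegral_add_le (φ : EuclideanSpace ℝ (Fin n) → ℝ≥0∞) {r s : ℝ}
    {u : EuclideanSpace ℝ (Fin n)} (hu : ‖u‖ < s) :
    ∫⁻ x in centeredCube n r, φ (x + u) ≤ ∫⁻ x in centeredCube n (r + s), φ x := by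
  rw [← lintegral_indicator (isOpen_centeredCube _).measurableSet,
    ← lintegral_indicator (isOpen_centeredCube _).measurableSet,
    ← lintegral_add_right_eq_self ((centeredCube n (r + s)).indicator φ) u]
  refine lintegral_mono fun x => ?_
  by_cases hx : x ∈ centeredCube n r
  · rw [indicator_of_mem hx, indicator_of_mem (add_mem_centeredCube hx hu)]
  · rw [indicator_of_notMem hx]
    exact zero_le

/-- Telescope along m steps of length |h|/m: convexity costs m^{q-1} and the m translated integrals
contribute another m. Enlarging the cube by R absorbs the translations. -/
theorem setLIntegral_enorm_sub_rpow_le (hq : 1 ≤ q) (hf : Measurable f) {R : ℝ}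
    {h : EuclideanSpace ℝ (Fin n)} (hh : ‖h‖ < R) {m : ℕ} (hm : 0 < m) :
    ∫⁻ x in centeredCube n R, ‖f (x + h) - f x‖ₑ ^ q ≤
      (m : ℝ≥0∞) ^ q * ∫⁻ x in centeredCube n (R + R), ‖f (x + (m : ℝ)⁻¹ • h) - f x‖ₑ ^ q := by
  have hm0 : (0 : ℝ) < m := by exact_mod_cast hm
  set u := (m : ℝ)⁻¹ • h with hu
  have hmu : (m : ℝ) • u = h := by rw [hu, smul_inv_smul₀ hm0.ne']
  have h1 : ∀ x, ‖f (x + h) - f x‖ₑ ^ q ≤ (m : ℝ≥0∞) ^ (q - 1) *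
      ∑ i ∈ Finset.range m, ‖f (x + (i : ℝ) • u + u) - f (x + (i : ℝ) • u)‖ₑ ^ q := fun x => by
    have h2 : f (x + h) - f x =
        ∑ i ∈ Finset.range m, (f (x + (i : ℝ) • u + u) - f (x + (i : ℝ) • u)) := by
      have := Finset.sum_range_sub (fun i : ℕ => f (x + (i : ℝ) • u)) m
      simp only [hmu, Nat.cast_zero, zero_smul, add_zero] at this
      rw [← this]
      refine Finset.sum_congr rfl fun i _ => ?_
      push_cast
      rw [add_smul, one_smul, add_assoc]
    rw [h2]
    refine (ENNReal.rpow_le_rpow (enorm_sum_le _ _) (by linarith)).trans ?_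
    simpa using ENNReal.rpow_sum_le_const_mul_sum_rpow (Finset.range m)
      (fun i => ‖f (x + (i : ℝ) • u + u) - f (x + (i : ℝ) • u)‖ₑ) hq
  calc ∫⁻ x in centeredCube n R, ‖f (x + h) - f x‖ₑ ^ q
      ≤ ∫⁻ x in centeredCube n R, (m : ℝ≥0∞) ^ (q - 1) *
      ∑ i ∈ Finset.range m, ‖f (x + (i : ℝ) • u + u) - f (x + (i : ℝ) • u)‖ₑ ^ q :=
        lintegral_mono h1
    _ = (m : ℝ≥0∞) ^ (q - 1) * ∑ i ∈ Finset.range m, ∫⁻ x in centeredCube n R,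
          ‖f (x + (i : ℝ) • u + u) - f (x + (i : ℝ) • u)‖ₑ ^ q := by
        rw [lintegral_const_mul _ (by fun_prop), lintegral_finsetSum _ fun i _ => by fun_prop]
    _ ≤ (m : ℝ≥0∞) ^ (q - 1) * ∑ i ∈ Finset.range m, ∫⁻ x in centeredCube n (R + R),
          ‖f (x + u) - f x‖ₑ ^ q := by
        refine mul_le_mul_right (Finset.sum_le_sum fun i hi => ?_) _
        refine setLIntegral_add_le (fun x => ‖f (x + u) - f x‖ₑ ^ q) (lt_of_le_of_lt ?_ hh)
        rw [← hmu, norm_smul _ u, norm_smul _ u]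
        refine mul_le_mul_of_nonneg_right ?_ (norm_nonneg u)
        simpa using (Finset.mem_range.1 hi).le
    _ = _ := by
        have hm1 : (m : ℝ≥0∞) ≠ 0 := by exact_mod_cast hm.ne'
        rw [Finset.sum_const, Finset.card_range, nsmul_eq_mul, ← mul_assoc]
        congr 1
        conv_lhs => rw [← ENNReal.rpow_one (m : ℝ≥0∞), ENNReal.rpow_one (m : ℝ≥0∞)]
        conv_rhs => rw [← sub_add_cancel q 1, ENNReal.rpow_add _ _ hm1 (by simp), ENNReal.rpow_one]

theorem lintegral_differences_le_energy (hf : Measurable f) (β : ℝ) {R : ℝ} (hR : 0 < R) :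
    ∫⁻ h in Metric.ball 0 R, (∫⁻ x in centeredCube n (R + R), ‖f (x + h) - f x‖ₑ ^ q) / ‖h‖ₑ ^ β ≤
      energy q β f (centeredCube n (R + R + R)) (centeredCube n (R + R + R)) := by
  have hm : Measurable fun z : EuclideanSpace ℝ (Fin n) × EuclideanSpace ℝ (Fin n) =>
      ‖f (z.2 + z.1) - f z.2‖ₑ ^ q / ‖z.1‖ₑ ^ β := by fun_prop
  calc ∫⁻ h in Metric.ball 0 R,
        (∫⁻ x in centeredCube n (R + R), ‖f (x + h) - f x‖ₑ ^ q) / ‖h‖ₑ ^ β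
      = ∫⁻ h in Metric.ball 0 R, ∫⁻ x in centeredCube n (R + R),
          ‖f (x + h) - f x‖ₑ ^ q / ‖h‖ₑ ^ β := by
        refine lintegral_congr fun h => ?_
        simp_rw [div_eq_mul_inv]
        rw [lintegral_mul_const _ (by fun_prop)]
    _ = ∫⁻ x in centeredCube n (R + R), ∫⁻ h in Metric.ball 0 R,
          ‖f (x + h) - f x‖ₑ ^ q / ‖h‖ₑ ^ β := lintegral_lintegral_swap hm.aemeasurable
    _ ≤ ∫⁻ x in centeredCube n (R + R), ∫⁻ y in centeredCube n (R + R + R),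
          ‖f x - f y‖ₑ ^ q / ‖x - y‖ₑ ^ β := by
        refine setLIntegral_mono' (isOpen_centeredCube _).measurableSet fun x hx => ?_
        rw [← lintegral_indicator Metric.isOpen_ball.measurableSet,
          ← lintegral_indicator (isOpen_centeredCube _).measurableSet,
          ← lintegral_add_left_eq_self ((centeredCube n (R + R + R)).indicator _) x]
        refine lintegral_mono fun h => ?_
        by_cases hh : h ∈ Metric.ball (0 : EuclideanSpace ℝ (Fin n)) R
        · rw [indicator_of_mem hh,
            indicator_of_mem (add_mem_centeredCube hx (by simpa using hh)), enorm_sub_rev (f x),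
            enorm_sub_rev x, add_sub_cancel_left]
        · rw [indicator_of_notMem hh]
          exact zero_le
    _ ≤ _ := lintegral_mono_set (centeredCube_mono (by linarith))

/-- The kernel |h|^{-(n+q)} exactly balances the subdivision loss m^q. Hence the integral over |h| <
R is at most the one over |h| < R/m on a larger cube, which tends to 0 as m → ∞. So f is invariant
under almost every translation, hence constant. -/
theorem mem_aeConstants_of_energy_ne_top (hn : 1 ≤ n) (hq : 1 ≤ q) (hf : Measurable f)
    (hE : ∀ R : ℝ, 0 < R → energy q (n + q) f (centeredCube n R) (centeredCube n R) ≠ ∞) :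
    f ∈ aeConstants 𝕜 n := by
  have hzero : ∀ R : ℝ, 0 < R → ∫⁻ h in Metric.ball 0 R,
      (∫⁻ x in centeredCube n R, ‖f (x + h) - f x‖ₑ ^ q) / ‖h‖ₑ ^ (n + q) = 0 := by
    intro R hR
    set T : EuclideanSpace ℝ (Fin n) → ℝ≥0∞ :=
      fun h => ∫⁻ x in centeredCube n (R + R), ‖f (x + h) - f x‖ₑ ^ q
    have hfin := ne_top_of_le_ne_top (hE (R + R + R) (by linarith))
      (lintegral_differences_le_energy (q := q) hf (n + q) hR)
    -- Absolute continuity of a finite integral: the balls of radius R/m have vanishing measure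
    -- because n ≥ 1.
    have hlim : Filter.Tendsto (fun m : ℕ => ∫⁻ h in Metric.ball 0 (R / m), T h / ‖h‖ₑ ^ (n + q))
        Filter.atTop (nhds 0) := by
      rw [← lintegral_indicator Metric.isOpen_ball.measurableSet] at hfin
      have hvol : Filter.Tendsto
          (fun m : ℕ => volume (Metric.ball (0 : EuclideanSpace ℝ (Fin n)) (R / m)))
          Filter.atTop (nhds 0) := by
        refine tendsto_of_tendsto_of_tendsto_of_le_of_le tendsto_const_nhds ?_
          (fun _ => zero_le) fun m => volume_ball_le _ _
        have h1 : Filter.Tendsto (fun m : ℕ => ENNReal.ofReal (2 * (R / m)) ^ n) Filter.atTop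
            (nhds (ENNReal.ofReal (2 * 0) ^ n)) :=
          ((ENNReal.continuous_pow n).tendsto _).comp (ENNReal.tendsto_ofReal
            ((tendsto_const_div_atTop_nhds_zero_nat R).const_mul 2))
        simpa [show n ≠ 0 by omega] using h1
      refine (tendsto_setLIntegral_zero hfin hvol).congr' ?_
      filter_upwards [Filter.eventually_ge_atTop 1] with m hm
      refine setLIntegral_congr_fun Metric.isOpen_ball.measurableSet fun h hh => ?_
      exact indicator_of_mem (Metric.ball_subset_ball
        (div_le_self hR.le (by exact_mod_cast hm)) hh) _
    refine nonpos_iff_eq_zero.1 (ge_of_tendsto hlim ?_)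
    filter_upwards [Filter.eventually_gt_atTop 0] with m hm
    have hm0 : (0 : ℝ) < m := by exact_mod_cast hm
    set φ : EuclideanSpace ℝ (Fin n) → ℝ≥0∞ :=
      (Metric.ball 0 (R / m)).indicator fun h => T h / ‖h‖ₑ ^ (n + q) with hφ
    calc ∫⁻ h in Metric.ball 0 R,
          (∫⁻ x in centeredCube n R, ‖f (x + h) - f x‖ₑ ^ q) / ‖h‖ₑ ^ (n + q)
        ≤ ∫⁻ h, (ENNReal.ofReal m ^ n)⁻¹ * φ ((m : ℝ)⁻¹ • h) := by
          rw [← lintegral_indicator Metric.isOpen_ball.measurableSet]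
          refine lintegral_mono fun h => ?_
          by_cases hh : h ∈ Metric.ball (0 : EuclideanSpace ℝ (Fin n)) R
          · have hh' : ‖h‖ < R := by simpa using hh
            have hmem : (m : ℝ)⁻¹ • h ∈ Metric.ball (0 : EuclideanSpace ℝ (Fin n)) (R / m) := by
              rw [mem_ball_zero_iff, norm_smul, norm_inv, Real.norm_natCast, inv_mul_eq_div]
              gcongr
            rw [indicator_of_mem hh, hφ, indicator_of_mem hmem]
            refine (ENNReal.div_le_div_right
              (setLIntegral_enorm_sub_rpow_le hq hf hh' hm) _).trans_eq ?_
            have hm1 : (m : ℝ≥0∞) ≠ 0 := by exact_mod_cast hm.ne'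
            have hhm : ‖h‖ₑ = m * ‖(m : ℝ)⁻¹ • h‖ₑ := by
              conv_lhs => rw [← smul_inv_smul₀ hm0.ne' h, enorm_smul]
              simp
            change _ * T ((m : ℝ)⁻¹ • h) / _ = _
            rw [hhm, ENNReal.mul_rpow_of_nonneg _ _ (by positivity), div_eq_mul_inv, div_eq_mul_inv,
              ENNReal.mul_inv (.inl (by simp [ENNReal.rpow_eq_zero_iff, hm1]))
                (.inl (ENNReal.rpow_ne_top_of_ne_zero hm1 (by simp))),
              add_comm (n : ℝ) q, ENNReal.rpow_add _ _ hm1 (by simp),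
              ENNReal.mul_inv (.inl (by simp [ENNReal.rpow_eq_zero_iff, hm1]))
                (.inl (ENNReal.rpow_ne_top_of_ne_zero hm1 (by simp))), ENNReal.ofReal_natCast,
              ENNReal.rpow_natCast]
            -- Writing |h| = m|h/m| turns the kernel into m^{-n} m^{-q} |h/m|^{-(n+q)}: m^{-q}
            -- cancels the subdivision factor, and m^{-n} is the Jacobian of h ↦ h/m.
            have hmq : (m : ℝ≥0∞) ^ q * ((m : ℝ≥0∞) ^ q)⁻¹ = 1 :=
              ENNReal.mul_inv_cancel (by simp [ENNReal.rpow_eq_zero_iff, hm1])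
                (ENNReal.rpow_ne_top_of_ne_zero hm1 (by simp))
            calc _ = ((m : ℝ≥0∞) ^ q * ((m : ℝ≥0∞) ^ q)⁻¹) * (((m : ℝ≥0∞) ^ n)⁻¹ *
                  (T ((m : ℝ)⁻¹ • h) * (‖(m : ℝ)⁻¹ • h‖ₑ ^ (q + n))⁻¹)) := by ring
              _ = _ := by rw [hmq, one_mul]
          · rw [indicator_of_notMem hh]
            exact zero_le
      _ = ∫⁻ h in Metric.ball 0 (R / m), T h / ‖h‖ₑ ^ (n + q) := by
          have h0 : ENNReal.ofReal m ^ n ≠ 0 := pow_ne_zero _ (by simpa using hm.ne')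
          rw [lintegral_const_mul' _ _ (by simpa using h0), lintegral_comp_inv_smul φ hm0,
            ← mul_assoc, ENNReal.inv_mul_cancel h0 (ENNReal.pow_ne_top (by simp)), one_mul, hφ,
            lintegral_indicator Metric.isOpen_ball.measurableSet]
  have hm : Measurable fun z : EuclideanSpace ℝ (Fin n) × EuclideanSpace ℝ (Fin n) =>
      ‖f (z.2 + z.1) - f z.2‖ₑ ^ q := by fun_prop
  have h1 : ∀ᵐ h : EuclideanSpace ℝ (Fin n), ∀ k : ℕ, ‖h‖ < k →
      ∀ᵐ x : EuclideanSpace ℝ (Fin n), x ∈ centeredCube n k → f (x + h) = f x := by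
    rw [ae_all_iff]
    intro k
    rcases Nat.eq_zero_or_pos k with rfl | hk
    · refine .of_forall fun h hh => absurd hh ?_
      simp
    have := hzero k (by exact_mod_cast hk)
    have hT : Measurable fun h : EuclideanSpace ℝ (Fin n) =>
        (∫⁻ x in centeredCube n k, ‖f (x + h) - f x‖ₑ ^ q) / ‖h‖ₑ ^ (n + q) :=
      hm.lintegral_prod_right'.div (by fun_prop)
    rw [lintegral_eq_zero_iff hT, Filter.EventuallyEq,
      ae_restrict_iff' Metric.isOpen_ball.measurableSet] at this
    filter_upwards [this] with h hh hhk
    have h2 := hh (by simpa using hhk)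
    rw [Pi.zero_apply, ENNReal.div_eq_zero_iff] at h2
    have h3 := h2.resolve_right (ENNReal.rpow_ne_top_of_nonneg (by positivity) enorm_ne_top)
    rw [lintegral_eq_zero_iff (by fun_prop), Filter.EventuallyEq,
      ae_restrict_iff' (isOpen_centeredCube _).measurableSet] at h3
    filter_upwards [h3] with x hx hxk
    have h4 := hx hxk
    simpa [ENNReal.rpow_eq_zero_iff, sub_eq_zero, (by linarith : 0 < q)] using h4
  have h2 : ∀ᵐ h : EuclideanSpace ℝ (Fin n), ∀ᵐ x : EuclideanSpace ℝ (Fin n),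
      f (x + h) = f x := by
    filter_upwards [h1] with h hh
    obtain ⟨N, hN⟩ := exists_nat_gt ‖h‖
    have h3 : ∀ᵐ x, ∀ k : ℕ, N ≤ k → x ∈ centeredCube n k → f (x + h) = f x := by
      rw [ae_all_iff]
      intro k
      by_cases hk : N ≤ k
      · filter_upwards [hh k (hN.trans_le (by exact_mod_cast hk))] with x hx _ using hx
      · exact .of_forall fun x hk' => absurd hk' hk
    filter_upwards [h3] with x hx
    obtain ⟨N', hN'⟩ := exists_nat_forall_mem_centeredCube x
    exact hx (max N N') (le_max_left _ _) (hN' _ (le_max_right _ _))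
  have hms : MeasurableSet {z : EuclideanSpace ℝ (Fin n) × EuclideanSpace ℝ (Fin n) |
      f (z.2 + z.1) = f z.2} := measurableSet_eq_fun (by fun_prop) (by fun_prop)
  -- Exchanging the quantifiers yields one x that works for almost every h, so f (x + h) = f x
  -- determines f almost everywhere.
  replace h2 := (Measure.ae_ae_comm (p := fun h x => f (x + h) = f x) hms).1 h2
  obtain ⟨x, hx⟩ := h2.exists
  refine ⟨f x, ?_⟩
  have h3 := (measurePreserving_add_left volume (-x)).quasiMeasurePreserving.ae hx
  filter_upwards [h3] with y hy
  rwa [add_neg_cancel_left] at hy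

theorem JNQ_eq_aeConstants_of_one_le (hn : 1 ≤ n) (hp : 1 ≤ p) (hq : 1 ≤ q) (hα : 1 ≤ α) :
    JNQ 𝕜 n p q α = aeConstants 𝕜 n := by
  refine JNQ_eq_aeConstants_of_forall_mem hp hq fun f hf hK =>
    mem_aeConstants_of_energy_ne_top hn hq hf fun R hR => ?_
  have hc := isCube_centeredCube (n := n) R
  have hR2 : 0 < 2 * R := by linarith
  refine ne_top_of_le_ne_top ?_ (energy_le_mul_energy f (γ := n + q * α) (by linarith)
    (by nlinarith) ENNReal.ofReal_ne_top hc.nullMeasurableSet hc.nullMeasurableSet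
    fun x hx y hy => hc.enorm_sub_le hR2 hx hy)
  refine ENNReal.mul_ne_top (ENNReal.rpow_ne_top_of_nonneg (by nlinarith) ENNReal.ofReal_ne_top)
    (ne_top_of_le_ne_top ?_ (energy_le_congruentSup hn hp hq f hR2 hc))
  exact ENNReal.mul_ne_top (ENNReal.rpow_ne_top_of_nonneg (by linarith) hK.ne)
    (ENNReal.rpow_ne_top_of_ne_zero (by simpa using hR) ENNReal.ofReal_ne_top)

end Translations

/-! ### Negative α: comparison with the mean oscillation -/

section MeanOscillation

variable {𝕜 : Type*} [RCLike 𝕜] {n : ℕ} {p q α : ℝ} {f : EuclideanSpace ℝ (Fin n) → 𝕜}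

theorem rpow_lintegral_le {Ω : Type*} [MeasurableSpace Ω] (μ : Measure Ω) [IsProbabilityMeasure μ]
    {g : Ω → ℝ≥0∞} (hg : AEMeasurable g μ) (hq : 1 ≤ q) :
    (∫⁻ x, g x ∂μ) ^ q ≤ ∫⁻ x, g x ^ q ∂μ := by
  have h := eLpNorm'_le_eLpNorm'_of_exponent_le zero_lt_one hq μ hg.aestronglyMeasurable
  simp only [eLpNorm', enorm_eq_self, ENNReal.rpow_one, div_one] at h
  rw [one_div, ENNReal.le_rpow_inv_iff (by linarith)] at h
  exact h

theorem rpow_setLIntegral_le {A : Set (EuclideanSpace ℝ (Fin n))} (h0 : volume A ≠ 0)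
    (ht : volume A ≠ ∞) {g : EuclideanSpace ℝ (Fin n) → ℝ≥0∞}
    (hg : AEMeasurable g (volume.restrict A)) (hq : 1 ≤ q) :
    ((volume A)⁻¹ * ∫⁻ x in A, g x) ^ q ≤ (volume A)⁻¹ * ∫⁻ x in A, g x ^ q := by
  have : IsProbabilityMeasure ((volume A)⁻¹ • volume.restrict A) :=
    ⟨by simp [ENNReal.inv_mul_cancel h0 ht]⟩
  simpa using rpow_lintegral_le ((volume A)⁻¹ • volume.restrict A) (hg.smul_measure _) hq

/-- Scaling reduces every radius to the unit ball, where β < n makes the power integrable. -/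
theorem exists_setLIntegral_ball_eq (hn : 1 ≤ n) {β : ℝ} (hβ : β < n) :
    ∃ C : ℝ≥0∞, C ≠ ∞ ∧ ∀ r : ℝ, 0 < r →
      ∫⁻ h in Metric.ball (0 : EuclideanSpace ℝ (Fin n)) r, (‖h‖ₑ ^ β)⁻¹ =
        C * ENNReal.ofReal r ^ (n - β) := by
  have hfr : Module.finrank ℝ (EuclideanSpace ℝ (Fin n)) = n := finrank_euclideanSpace_fin
  have hnt : Nontrivial (EuclideanSpace ℝ (Fin n)) :=
    Module.nontrivial_of_finrank_pos (R := ℝ) (by omega)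
  refine ⟨∫⁻ h in Metric.ball (0 : EuclideanSpace ℝ (Fin n)) 1, (‖h‖ₑ ^ β)⁻¹, ?_,
    fun r hr => ?_⟩
  · have hi : IntegrableOn (fun x : EuclideanSpace ℝ (Fin n) => ‖x‖ ^ (-β))
        (Metric.ball 0 1) volume := by
      refine integrableOn_ball_of_norm_le_rpow (C := 1) (α := β) (by omega) (by rwa [hfr])
        (.of_forall fun x => ?_) (measurable_norm.pow_const _).aestronglyMeasurable
      rw [one_mul, Real.norm_of_nonneg (by positivity)]
    refine ne_of_eq_of_ne (lintegral_congr_ae ?_) hi.2.ne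
    have h0 : ∀ᵐ x : EuclideanSpace ℝ (Fin n), x ≠ 0 := by
      simp [ae_iff]
    filter_upwards [ae_restrict_of_ae h0] with x hx
    rw [← ENNReal.rpow_neg, ← ofReal_norm, ← ofReal_norm,
      ENNReal.ofReal_rpow_of_pos (norm_pos_iff.2 hx), Real.norm_of_nonneg (by positivity)]
  · set φ : EuclideanSpace ℝ (Fin n) → ℝ≥0∞ :=
      (Metric.ball 0 1).indicator fun h => (‖h‖ₑ ^ β)⁻¹ with hφ
    have hL0 : ENNReal.ofReal r ≠ 0 := by simpa using hr
    have h1 : ∀ h, (Metric.ball (0 : EuclideanSpace ℝ (Fin n)) r).indicator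
        (fun h => (‖h‖ₑ ^ β)⁻¹) h = ENNReal.ofReal r ^ (-β) * φ (r⁻¹ • h) := fun h => by
      have hmem : h ∈ Metric.ball (0 : EuclideanSpace ℝ (Fin n)) r ↔
          r⁻¹ • h ∈ Metric.ball (0 : EuclideanSpace ℝ (Fin n)) 1 := by
        rw [mem_ball_zero_iff, mem_ball_zero_iff, norm_smul, norm_inv, Real.norm_of_nonneg hr.le,
          inv_mul_lt_iff₀ hr, mul_one]
      by_cases hh : h ∈ Metric.ball (0 : EuclideanSpace ℝ (Fin n)) r
      · rw [indicator_of_mem hh, hφ, indicator_of_mem (hmem.1 hh)]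
        have h2 : ‖h‖ₑ = ENNReal.ofReal r * ‖r⁻¹ • h‖ₑ := by
          conv_lhs => rw [← smul_inv_smul₀ hr.ne' h, enorm_smul]
          rw [Real.enorm_of_nonneg hr.le]
        rw [h2, ← ENNReal.rpow_neg, ← ENNReal.rpow_neg,
          ENNReal.mul_rpow_of_ne_top (by simp) enorm_ne_top]
      · rw [indicator_of_notMem hh, hφ, indicator_of_notMem (fun h' => hh (hmem.2 h')), mul_zero]
    rw [← lintegral_indicator Metric.isOpen_ball.measurableSet]
    simp_rw [h1]
    rw [lintegral_const_mul' _ _ (ENNReal.rpow_ne_top_of_ne_zero hL0 (by simp)),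
      lintegral_comp_inv_smul φ hr, hφ, lintegral_indicator Metric.isOpen_ball.measurableSet,
      ← mul_assoc, mul_comm, ← ENNReal.rpow_natCast, ← ENNReal.rpow_add _ _ hL0 (by simp)]
    congr 2
    ring

theorem setLIntegral_inv_rpow_le {ℓ : ℝ} (hℓ : 0 < ℓ) (hn : 1 ≤ n)
    {Q : Set (EuclideanSpace ℝ (Fin n))} (hQ : IsCube ℓ Q) {x : EuclideanSpace ℝ (Fin n)}
    (hx : x ∈ Q) (β : ℝ) :
    ∫⁻ y in Q, (‖x - y‖ₑ ^ β)⁻¹ ≤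
      ∫⁻ h in Metric.ball (0 : EuclideanSpace ℝ (Fin n)) (2 * √n * ℓ), (‖h‖ₑ ^ β)⁻¹ := by
  have hn' : 0 < √(n : ℝ) := Real.sqrt_pos.2 (by exact_mod_cast hn)
  calc ∫⁻ y in Q, (‖x - y‖ₑ ^ β)⁻¹
      ≤ ∫⁻ y in Q, (Metric.ball 0 (2 * √n * ℓ)).indicator (fun h => (‖h‖ₑ ^ β)⁻¹) (x - y) := by
        refine lintegral_mono_ae ?_
        filter_upwards [ae_restrict_mem₀ hQ.nullMeasurableSet] with y hy
        rw [indicator_of_mem]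
        rw [mem_ball_zero_iff]
        have h1 := hQ.enorm_sub_le hℓ hx hy
        rw [← ofReal_norm, ENNReal.ofReal_le_ofReal_iff (by positivity)] at h1
        nlinarith [mul_pos hn' hℓ]
    _ ≤ ∫⁻ y, (Metric.ball 0 (2 * √n * ℓ)).indicator (fun h => (‖h‖ₑ ^ β)⁻¹) (x - y) :=
        setLIntegral_le_lintegral _ _
    _ = _ := by
        rw [lintegral_sub_left_eq_self
          ((Metric.ball (0 : EuclideanSpace ℝ (Fin n)) (2 * √n * ℓ)).indicator
            (fun h => (‖h‖ₑ ^ β)⁻¹)) x, lintegral_indicator Metric.isOpen_ball.measurableSet]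

/-- Insert the average f_Q between f x and f y. As n + qα < n, the kernel can be integrated out in
the variable the remaining term does not contain, giving a multiple of ℓ^{-qα}. -/
theorem exists_phi_le_mul_meanOsc (hn : 1 ≤ n) (hq : 1 ≤ q) (hα : α < 0) :
    ∃ C : ℝ≥0∞, C ≠ ∞ ∧ ∀ f : EuclideanSpace ℝ (Fin n) → 𝕜, Measurable f →
      ∀ ℓ : ℝ, 0 < ℓ → ∀ Q, IsCube ℓ Q → phi q α f Q ≤ C * meanOsc q f Q := by
  have hn' : 0 < √(n : ℝ) := Real.sqrt_pos.2 (by exact_mod_cast hn)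
  have hq0 : 0 < q := by linarith
  have hn0 : (n : ℝ) ≠ 0 := by positivity
  obtain ⟨c, hct, hc⟩ := exists_setLIntegral_ball_eq hn (β := n + q * α) (by nlinarith)
  set C : ℝ≥0∞ := 2 ^ (q - 1) * 2 * (c * ENNReal.ofReal (2 * √n) ^ (-(q * α))) with hC
  have hCt : C ≠ ∞ := by
    have h3 : (2 : ℝ≥0∞) ^ (q - 1) ≠ ∞ := ENNReal.rpow_ne_top_of_ne_zero (by simp) (by simp)
    have h4 : ENNReal.ofReal (2 * √n) ^ (-(q * α)) ≠ ∞ :=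
      ENNReal.rpow_ne_top_of_nonneg (by nlinarith) ENNReal.ofReal_ne_top
    finiteness
  refine ⟨C ^ (1 / q), ENNReal.rpow_ne_top_of_nonneg (by positivity) hCt,
    fun f hf ℓ hℓ Q hQ => ?_⟩
  set L := ENNReal.ofReal ℓ with hL
  have hL0 : L ≠ 0 := by simpa [hL] using hℓ
  have hLt : L ≠ ∞ := by simp [hL]
  set a := ⨍ y in Q, f y
  set κ : ℝ≥0∞ := c * ENNReal.ofReal (2 * √n) ^ (-(q * α)) * L ^ (-(q * α)) with hκ
  have hκx : ∀ x ∈ Q, ∫⁻ y in Q, (‖x - y‖ₑ ^ (n + q * α))⁻¹ ≤ κ := fun x hx => by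
    refine (setLIntegral_inv_rpow_le hℓ hn hQ hx _).trans_eq ?_
    rw [hc _ (by positivity), hκ, show (n : ℝ) - (n + q * α) = -(q * α) by ring,
      ENNReal.ofReal_mul (by positivity), ENNReal.mul_rpow_of_nonneg _ _ (by nlinarith),
      ← mul_assoc]
  set g : EuclideanSpace ℝ (Fin n) → ℝ≥0∞ := fun x => ‖f x - a‖ₑ ^ q with hg
  have hgm : Measurable g := by fun_prop
  have hI : ∫⁻ x in Q, ∫⁻ y in Q, g x * (‖x - y‖ₑ ^ (n + q * α))⁻¹ ≤ κ * ∫⁻ x in Q, g x := by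
    rw [← lintegral_const_mul _ hgm]
    refine lintegral_mono_ae ?_
    filter_upwards [ae_restrict_mem₀ hQ.nullMeasurableSet] with x hx
    rw [lintegral_const_mul _ (by fun_prop), mul_comm]
    gcongr
    exact hκx x hx
  have hI' : ∫⁻ x in Q, ∫⁻ y in Q, g y * (‖x - y‖ₑ ^ (n + q * α))⁻¹ ≤ κ * ∫⁻ x in Q, g x := by
    rw [lintegral_lintegral_swap (by fun_prop)]
    refine le_trans (le_of_eq (lintegral_congr fun y => lintegral_congr fun x => ?_)) hI
    rw [enorm_sub_rev]
  have hE : energy q (n + q * α) f Q Q ≤ 2 ^ (q - 1) * 2 * κ * ∫⁻ x in Q, g x := by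
    calc energy q (n + q * α) f Q Q
        ≤ ∫⁻ x in Q, ∫⁻ y in Q, 2 ^ (q - 1) * (g x * (‖x - y‖ₑ ^ (n + q * α))⁻¹ +
            g y * (‖x - y‖ₑ ^ (n + q * α))⁻¹) := by
          refine lintegral_mono fun x => lintegral_mono fun y => ?_
          rw [div_eq_mul_inv, ← add_mul, ← mul_assoc]
          exact mul_le_mul_left (enorm_sub_rpow_le hq _ _ a) _
      _ = 2 ^ (q - 1) * ((∫⁻ x in Q, ∫⁻ y in Q, g x * (‖x - y‖ₑ ^ (n + q * α))⁻¹) +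
            ∫⁻ x in Q, ∫⁻ y in Q, g y * (‖x - y‖ₑ ^ (n + q * α))⁻¹) := by
          have hm1 : Measurable fun z : EuclideanSpace ℝ (Fin n) × EuclideanSpace ℝ (Fin n) =>
              g z.1 * (‖z.1 - z.2‖ₑ ^ (n + q * α))⁻¹ := by fun_prop
          rw [← lintegral_add_left hm1.lintegral_prod_right',
            ← lintegral_const_mul' _ _ (ENNReal.rpow_ne_top_of_ne_zero (by simp) (by simp))]
          refine lintegral_congr fun x => ?_
          rw [lintegral_const_mul' _ _ (ENNReal.rpow_ne_top_of_ne_zero (by simp) (by simp)),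
            lintegral_add_left (by fun_prop)]
      _ ≤ 2 ^ (q - 1) * (κ * (∫⁻ x in Q, g x) + κ * ∫⁻ x in Q, g x) := by gcongr
      _ = _ := by ring
  rw [phi_eq, meanOsc, ← ENNReal.mul_rpow_of_nonneg _ _ (by positivity)]
  refine ENNReal.rpow_le_rpow ?_ (by positivity)
  calc volume Q ^ (q * α / n - 1) * energy q (n + q * α) f Q Q
      ≤ volume Q ^ (q * α / n - 1) * (2 ^ (q - 1) * 2 * κ * ∫⁻ x in Q, g x) := by gcongr
    _ = (volume Q ^ (q * α / n - 1) * L ^ (-(q * α))) * (C * ∫⁻ x in Q, g x) := by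
        rw [hκ, hC]
        ring
    _ = C * ((volume Q)⁻¹ * ∫⁻ x in Q, g x) := by
        have : volume Q ^ (q * α / n - 1) * L ^ (-(q * α)) = (volume Q)⁻¹ := by
          rw [hQ.volume_eq_rpow, ← ENNReal.rpow_mul, ← ENNReal.rpow_neg,
            ← ENNReal.rpow_add _ _ hL0 hLt]
          congr 1
          field_simp
          ring
        rw [this]
        ring

/-- For some x the function f x - f has finite q-th power integral over Q, and t ≤ 1 + t^q makes it
integrable on a set of finite measure. -/
theorem integrableOn_of_energy_ne_top (hq : 1 ≤ q) (hf : Measurable f)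
    {Q : Set (EuclideanSpace ℝ (Fin n))} (h0 : volume Q ≠ 0) (ht : volume Q ≠ ∞)
    (hE : energy q 0 f Q Q ≠ ∞) : IntegrableOn f Q volume := by
  rw [energy_zero] at hE
  have hm : Measurable fun z : EuclideanSpace ℝ (Fin n) × EuclideanSpace ℝ (Fin n) =>
      ‖f z.1 - f z.2‖ₑ ^ q := by fun_prop
  have h1 := ae_lt_top hm.lintegral_prod_right' hE
  have : NeZero (volume.restrict Q) := ⟨by simpa using h0⟩
  have : IsFiniteMeasure (volume.restrict Q) := ⟨by simpa using ht.lt_top⟩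
  obtain ⟨x, hx⟩ := h1.exists
  have h2 : Integrable (fun y => f x - f y) (volume.restrict Q) := by
    refine ⟨by fun_prop, ?_⟩
    calc ∫⁻ y in Q, ‖f x - f y‖ₑ ≤ ∫⁻ y in Q, (1 + ‖f x - f y‖ₑ ^ q) := by
          refine lintegral_mono fun y => ?_
          rcases le_total ‖f x - f y‖ₑ 1 with h | h
          · exact h.trans le_self_add
          · refine le_trans ?_ le_add_self
            simpa using ENNReal.rpow_le_rpow_of_exponent_le h hq
      _ < ∞ := by
          rw [lintegral_add_left measurable_const]
          simp [ht.lt_top, hx]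
  exact ((integrable_const (f x)).sub h2).congr (.of_forall fun y => sub_sub_cancel _ _)

/-- f x - f_Q is the average over y of f x - f y; apply Jensen. -/
theorem meanOsc_le_energy (hq : 1 ≤ q) (hf : Measurable f)
    {Q : Set (EuclideanSpace ℝ (Fin n))} (h0 : volume Q ≠ 0) (ht : volume Q ≠ ∞)
    (hi : IntegrableOn f Q volume) :
    meanOsc q f Q ≤ ((volume Q)⁻¹ * ((volume Q)⁻¹ * energy q 0 f Q Q)) ^ (1 / q) := by
  have hfin : IsFiniteMeasure (volume.restrict Q) := ⟨by simpa using ht.lt_top⟩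
  have hv : volume.real Q ≠ 0 := by simp [measureReal_def, ENNReal.toReal_eq_zero_iff, h0, ht]
  unfold meanOsc
  refine ENNReal.rpow_le_rpow (mul_le_mul_right ?_ _) (by positivity)
  rw [energy_zero, ← lintegral_const_mul' _ _ (by simpa using h0)]
  refine lintegral_mono fun x => ?_
  refine le_trans (ENNReal.rpow_le_rpow ?_ (by linarith))
    (rpow_setLIntegral_le h0 ht (g := fun y => ‖f x - f y‖ₑ) (by fun_prop) hq)
  have h1 : f x - ⨍ y in Q, f y = (volume.real Q)⁻¹ • ∫ y in Q, (f x - f y) := by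
    rw [integral_sub (integrable_const _) hi, setAverage_eq, smul_sub, setIntegral_const,
      inv_smul_smul₀ hv]
  rw [h1, enorm_smul]
  have h2 : ‖(volume.real Q)⁻¹‖ₑ = (volume Q)⁻¹ := by
    rw [enorm_inv hv, Real.enorm_of_nonneg measureReal_nonneg, measureReal_def,
      ENNReal.ofReal_toReal ht]
  rw [h2]
  gcongr
  exact enorm_integral_le_lintegral_enorm _

theorem JNQ_eq_JNcon (hn : 1 ≤ n) (hp : 1 ≤ p) (hq : 1 ≤ q) (hα : α < 0) :
    JNQ 𝕜 n p q α = JNcon 𝕜 n p q := by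
  have hp0 : 0 < p := by linarith
  have hq0 : 0 < q := by linarith
  have hn0 : (n : ℝ) ≠ 0 := by positivity
  refine Subset.antisymm (fun f hf => ?_) fun f hf => ?_
  · obtain ⟨g, hg, hfg, hgs⟩ := exists_measurable_of_mem_JNQ hf
    obtain ⟨C, hCt, hC⟩ := exists_energy_zero_le (𝕜 := 𝕜) hn hq (n + q * α)
    have hint : ∀ ℓ : ℝ, 0 < ℓ → ∀ Q, IsCube ℓ Q → IntegrableOn g Q volume := by
      intro ℓ hℓ Q hQ
      have hL0 : ENNReal.ofReal ℓ ≠ 0 := by simpa using hℓ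
      refine integrableOn_of_energy_ne_top hq hg (hQ.volume_ne_zero hℓ) hQ.volume_ne_top ?_
      refine ne_top_of_le_ne_top ?_ (hC g hg ℓ hℓ Q hQ)
      refine ENNReal.mul_ne_top (ENNReal.mul_ne_top hCt
        (ENNReal.rpow_ne_top_of_ne_zero hL0 ENNReal.ofReal_ne_top))
        (ne_top_of_le_ne_top ?_ (energy_le_congruentSup hn hp hq g hℓ hQ))
      exact ENNReal.mul_ne_top (ENNReal.rpow_ne_top_of_nonneg hq0.le hgs.ne)
        (ENNReal.rpow_ne_top_of_ne_zero hL0 ENNReal.ofReal_ne_top)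
    have hloc : LocallyIntegrable g volume := by
      intro x
      refine ⟨centeredCube n (‖x‖ + 1), (isOpen_centeredCube _).mem_nhds
        (mem_centeredCube (by linarith)), hint _ (by positivity) _ (isCube_centeredCube _)⟩
    refine ⟨hloc.congr hfg.symm, ?_⟩
    rw [show meanOsc q f = meanOsc q g from funext fun Q => meanOsc_congr_ae hfg Q]
    refine congruentSup_lt_top_of_le hp0 (C := C ^ (1 / q))
      (ENNReal.rpow_ne_top_of_nonneg (by positivity) hCt) (fun ℓ hℓ Q hQ => ?_) hgs
    refine (meanOsc_le_energy hq hg (hQ.volume_ne_zero hℓ) hQ.volume_ne_top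
      (hint ℓ hℓ Q hQ)).trans ?_
    have hL0 : ENNReal.ofReal ℓ ≠ 0 := by simpa using hℓ
    rw [phi_eq, ← ENNReal.mul_rpow_of_nonneg _ _ (by positivity)]
    refine ENNReal.rpow_le_rpow ?_ (by positivity)
    calc (volume Q)⁻¹ * ((volume Q)⁻¹ * energy q 0 g Q Q)
        ≤ (volume Q)⁻¹ * ((volume Q)⁻¹ * (C * ENNReal.ofReal ℓ ^ (n + q * α) *
            energy q (n + q * α) g Q Q)) := by
          gcongr
          exact hC g hg ℓ hℓ Q hQ
      _ = C * (((volume Q)⁻¹ * (volume Q)⁻¹ * ENNReal.ofReal ℓ ^ (n + q * α)) *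
            energy q (n + q * α) g Q Q) := by ring
      _ = _ := by
          congr 2
          rw [hQ.volume_eq_rpow, ← ENNReal.rpow_neg, ← ENNReal.rpow_mul,
            ← ENNReal.rpow_add _ _ hL0 ENNReal.ofReal_ne_top,
            ← ENNReal.rpow_add _ _ hL0 ENNReal.ofReal_ne_top]
          congr 1
          field_simp
          ring
  · obtain ⟨h1, h2⟩ := hf
    have h3 := h1.aestronglyMeasurable
    obtain ⟨C, hCt, hC⟩ := exists_phi_le_mul_meanOsc (𝕜 := 𝕜) hn hq hα
    refine ⟨h3, congruentSup_lt_top_of_le hp0 hCt (fun ℓ hℓ Q hQ => ?_) h2⟩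
    rw [phi_congr_ae h3.ae_eq_mk, meanOsc_congr_ae h3.ae_eq_mk]
    exact hC _ h3.stronglyMeasurable_mk.measurable ℓ hℓ Q hQ

/-! ### Summation against an integrable density, and the fractional Sobolev embedding -/

theorem congruentSup_lt_top_of_le_setLIntegral (hp : 0 < p)
    {Φ : Set (EuclideanSpace ℝ (Fin n)) → ℝ≥0∞} {F : EuclideanSpace ℝ (Fin n) → ℝ≥0∞}
    {C : ℝ≥0∞} (hC : C ≠ ∞) (hF : ∫⁻ x, F x ≠ ∞) {r : ℝ} (hr : 1 ≤ r)
    (h : ∀ ℓ : ℝ, 0 < ℓ → ∀ Q, IsCube ℓ Q → volume Q * Φ Q ^ p ≤ (C * ∫⁻ x in Q, F x) ^ r) :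
    congruentSup p Φ < ∞ := by
  refine congruentSup_lt_top hp (C := (C * ∫⁻ x, F x) ^ r)
    (ENNReal.rpow_ne_top_of_nonneg (by linarith) (ENNReal.mul_ne_top hC hF)) fun ℓ hℓ S hS => ?_
  refine (ENNReal.tsum_le_tsum fun Q : S => h ℓ hℓ Q (hS.1 Q Q.2)).trans
    ((tsum_rpow_le_rpow_tsum _ hr).trans ?_)
  rw [ENNReal.tsum_mul_left]
  gcongr
  exact tsum_setLIntegral_le hℓ hS F

theorem volume_mul_phi_rpow_eq (hn : 1 ≤ n) (hp : 0 < p) (hq : 0 < q)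
    (f : EuclideanSpace ℝ (Fin n) → 𝕜) {ℓ : ℝ} (hℓ : 0 < ℓ)
    {Q : Set (EuclideanSpace ℝ (Fin n))} (hQ : IsCube ℓ Q) :
    volume Q * phi q α f Q ^ p = (ENNReal.ofReal ℓ ^ (q * (α - n * (1 / q - 1 / p))) *
      energy q (n + q * α) f Q Q) ^ (p / q) := by
  have hn0 : (n : ℝ) ≠ 0 := by positivity
  have hL0 : ENNReal.ofReal ℓ ≠ 0 := by simpa using hℓ
  rw [phi_eq, ← ENNReal.rpow_mul, one_div_mul_eq_div, ENNReal.mul_rpow_of_nonneg _ _ (by positivity),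
    ENNReal.mul_rpow_of_nonneg _ _ (by positivity), ← mul_assoc, hQ.volume_eq_rpow,
    ← ENNReal.rpow_mul, ← ENNReal.rpow_mul, ← ENNReal.rpow_mul,
    ← ENNReal.rpow_add _ _ hL0 ENNReal.ofReal_ne_top]
  congr 2
  field_simp
  ring

theorem fracSobolev_subset_JNQ (hn : 1 ≤ n) (hp : 1 ≤ p) (hq : 1 ≤ q)
    (h0 : 0 < n * (1 / q - 1 / p)) (hα : α ≤ n * (1 / q - 1 / p)) :
    fracSobolev 𝕜 n (n * (1 / q - 1 / p)) q ⊆ JNQ 𝕜 n p q α := by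
  have hp0 : 0 < p := by linarith
  have hq0 : 0 < q := by linarith
  set s : ℝ := n * (1 / q - 1 / p) with hs
  -- α₀ > 0 means q < p, so the power p/q is admissible for summing over the cubes.
  have hqp : 1 ≤ p / q := by
    have h1 : 1 / p < 1 / q := by
      have := pos_of_mul_pos_right (a := (n : ℝ)) h0 (by positivity)
      linarith
    rw [one_le_div hq0]
    exact (lt_of_one_div_lt_one_div hp0 h1).le
  rintro f ⟨hf, hfs⟩
  refine ⟨hf, ?_⟩
  rw [one_div, ENNReal.rpow_lt_top_iff_of_pos (by positivity), mul_comm s q] at hfs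
  refine congruentSup_lt_top_of_le_setLIntegral hp0 (C := ENNReal.ofReal √n ^ (q * (s - α)))
    (ENNReal.rpow_ne_top_of_nonneg (mul_nonneg hq0.le (by linarith)) ENNReal.ofReal_ne_top)
    hfs.ne hqp fun ℓ hℓ Q hQ => ?_
  have hL0 : ENNReal.ofReal ℓ ≠ 0 := by simpa using hℓ
  rw [volume_mul_phi_rpow_eq hn hp0 hq0 f hℓ hQ]
  refine ENNReal.rpow_le_rpow ?_ (by positivity)
  have h1 := energy_le_mul_energy f (q := q) (β := n + q * α) (γ := n + q * s) hq0
    (by gcongr) ENNReal.ofReal_ne_top hQ.nullMeasurableSet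
    hQ.nullMeasurableSet fun x hx y hy => hQ.enorm_sub_le hℓ hx hy
  calc ENNReal.ofReal ℓ ^ (q * (α - s)) * energy q (n + q * α) f Q Q
      ≤ ENNReal.ofReal ℓ ^ (q * (α - s)) * (ENNReal.ofReal (√n * ℓ) ^
          (n + q * s - (n + q * α)) * energy q (n + q * s) f Q Q) := by gcongr
    _ = ENNReal.ofReal √n ^ (q * (s - α)) * energy q (n + q * s) f Q Q := by
        rw [show (n + q * s - (n + q * α)) = q * (s - α) by ring,
          ENNReal.ofReal_mul (by positivity),
          ENNReal.mul_rpow_of_nonneg _ _ (mul_nonneg hq0.le (by linarith)),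
          mul_comm (ENNReal.ofReal √n ^ _), ← mul_assoc, ← mul_assoc,
          ← ENNReal.rpow_add _ _ hL0 ENNReal.ofReal_ne_top,
          show q * (α - s) + q * (s - α) = 0 by ring, ENNReal.rpow_zero, one_mul]
    _ ≤ _ := by
        gcongr
        exact lintegral_mono fun x => setLIntegral_le_lintegral _ _

end MeanOscillation

/-! ### The homogeneous Sobolev embedding by mollification -/

section Mollification

variable {𝕜 : Type*} [RCLike 𝕜] {n : ℕ} {p q α : ℝ} {f : EuclideanSpace ℝ (Fin n) → 𝕜}
  {g : EuclideanSpace ℝ (Fin n) → EuclideanSpace 𝕜 (Fin n)}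

open scoped Convolution

/-- The mollification of `f` by the normed bump function `φ`. -/
noncomputable def mollify (φ : ContDiffBump (0 : EuclideanSpace ℝ (Fin n)))
    (f : EuclideanSpace ℝ (Fin n) → 𝕜) : EuclideanSpace ℝ (Fin n) → 𝕜 :=
  φ.normed volume ⋆[ContinuousLinearMap.lsmul ℝ ℝ, volume] f

/-- The probability measure whose density is the normed bump function `φ`. -/
noncomputable def bumpMeasure (φ : ContDiffBump (0 : EuclideanSpace ℝ (Fin n))) :
    Measure (EuclideanSpace ℝ (Fin n)) :=
  volume.withDensity fun x => ENNReal.ofReal (φ.normed volume x)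

instance isProbabilityMeasure_bumpMeasure (φ : ContDiffBump (0 : EuclideanSpace ℝ (Fin n))) :
    IsProbabilityMeasure (bumpMeasure φ) := by
  refine ⟨?_⟩
  rw [bumpMeasure, withDensity_apply _ MeasurableSet.univ, Measure.restrict_univ,
    ← ofReal_integral_eq_lintegral_ofReal φ.integrable_normed
      (.of_forall fun x => φ.nonneg_normed x), φ.integral_normed, ENNReal.ofReal_one]

theorem contDiff_mollify (φ : ContDiffBump (0 : EuclideanSpace ℝ (Fin n)))
    (hf : LocallyIntegrable f volume) : ContDiff ℝ 1 (mollify φ f) :=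
  HasCompactSupport.contDiff_convolution_left _ φ.hasCompactSupport_normed
    (φ.contDiff_normed (n := 1)) hf

theorem fderiv_mollify_apply (φ : ContDiffBump (0 : EuclideanSpace ℝ (Fin n)))
    (hf : LocallyIntegrable f volume) (x h : EuclideanSpace ℝ (Fin n)) :
    fderiv ℝ (mollify φ f) x h = ∫ t, fderiv ℝ (φ.normed volume) (x - t) h • f t := by
  have h1 := (φ.hasCompactSupport_normed (μ := volume)).hasFDerivAt_convolution_left
    (ContinuousLinearMap.lsmul ℝ ℝ) (φ.contDiff_normed (n := 1)) hf x
  have h2 : ConvolutionExistsAt (fderiv ℝ (φ.normed volume)) f x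
      ((ContinuousLinearMap.lsmul ℝ ℝ).precompL (EuclideanSpace ℝ (Fin n))) volume :=
    (φ.hasCompactSupport_normed.fderiv ℝ).convolutionExists_left _
      ((φ.contDiff_normed (n := 1)).continuous_fderiv one_ne_zero) hf x
  rw [mollify, h1.fderiv, convolution_eq_swap,
    ContinuousLinearMap.integral_apply h2.integrable_swap]
  rfl

/-- Use t ↦ φ(x - t) as test function; the sign from the inner derivative cancels the one in the
weak gradient identity. -/
theorem fderiv_mollify_single (φ : ContDiffBump (0 : EuclideanSpace ℝ (Fin n)))
    (hfg : IsWeakGradient f g) (x : EuclideanSpace ℝ (Fin n)) (i : Fin n) :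
    fderiv ℝ (mollify φ f) x (EuclideanSpace.single i 1) =
      ∫ t, φ.normed volume (x - t) • g t i := by
  rw [fderiv_mollify_apply φ hfg.1]
  have h1 : ContDiff ℝ (⊤ : ℕ∞) fun t => φ.normed volume (x - t) :=
    φ.contDiff_normed.comp (contDiff_const.sub contDiff_id)
  have h2 : HasCompactSupport fun t => φ.normed volume (x - t) :=
    φ.hasCompactSupport_normed.comp_homeomorph (Homeomorph.subLeft x)
  have h3 := hfg.2.2 _ h1 h2 i
  have h4 : ∀ t, fderiv ℝ (fun t => φ.normed volume (x - t)) t (EuclideanSpace.single i 1) =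
      -fderiv ℝ (φ.normed volume) (x - t) (EuclideanSpace.single i 1) := fun t => by
    have h5 : HasFDerivAt (fun t => φ.normed volume (x - t))
        ((fderiv ℝ (φ.normed volume) (x - t)).comp
          (-ContinuousLinearMap.id ℝ (EuclideanSpace ℝ (Fin n)))) t :=
      HasFDerivAt.comp t
        ((φ.contDiff_normed (n := 1)).differentiable one_ne_zero (x - t)).hasFDerivAt
        ((hasFDerivAt_id t).const_sub x)
    rw [h5.fderiv]
    simp
  simp_rw [h4, neg_smul] at h3
  rw [integral_neg, neg_inj] at h3
  exact h3

theorem enorm_fderiv_mollify_le (φ : ContDiffBump (0 : EuclideanSpace ℝ (Fin n)))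
    (hfg : IsWeakGradient f g) {Γ : EuclideanSpace ℝ (Fin n) → ℝ≥0∞} (hΓ : Measurable Γ)
    (hgΓ : ∀ᵐ x, ‖g x‖ₑ = Γ x) (x h : EuclideanSpace ℝ (Fin n)) :
    ‖fderiv ℝ (mollify φ f) x h‖ₑ ≤ n * ‖h‖ₑ * ∫⁻ s, Γ (x - s) ∂bumpMeasure φ := by
  have h0 : ∫⁻ s, Γ (x - s) ∂bumpMeasure φ =
      ∫⁻ t, ENNReal.ofReal (φ.normed volume (x - t)) * Γ t := by
    rw [bumpMeasure, lintegral_withDensity_eq_lintegral_mul _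
      (φ.continuous_normed.measurable.ennreal_ofReal) (by fun_prop),
      ← lintegral_sub_left_eq_self _ x]
    simp
  have h1 : ∀ i, ‖fderiv ℝ (mollify φ f) x (EuclideanSpace.single i 1)‖ₑ ≤
      ∫⁻ s, Γ (x - s) ∂bumpMeasure φ := fun i => by
    rw [fderiv_mollify_single φ hfg, h0]
    refine (enorm_integral_le_lintegral_enorm _).trans (lintegral_mono_ae ?_)
    filter_upwards [hgΓ] with t ht
    rw [enorm_smul, Real.enorm_of_nonneg (φ.nonneg_normed _), ← ht]
    gcongr
    rw [← ofReal_norm, ← ofReal_norm]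
    exact ENNReal.ofReal_le_ofReal (PiLp.norm_apply_le _ _)
  have h2 : h = ∑ i, h i • EuclideanSpace.single i (1 : ℝ) := by
    conv_lhs => rw [← (EuclideanSpace.basisFun (Fin n) ℝ).sum_repr h]
    simp
  calc ‖fderiv ℝ (mollify φ f) x h‖ₑ
      = ‖∑ i, h i • fderiv ℝ (mollify φ f) x (EuclideanSpace.single i 1)‖ₑ := by
        conv_lhs => rw [h2, map_sum]
        simp
    _ ≤ ∑ i, ‖h i • fderiv ℝ (mollify φ f) x (EuclideanSpace.single i 1)‖ₑ := enorm_sum_le _ _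
    _ ≤ ∑ _i : Fin n, ‖h‖ₑ * ∫⁻ s, Γ (x - s) ∂bumpMeasure φ := by
        refine Finset.sum_le_sum fun i _ => ?_
        rw [enorm_smul]
        gcongr
        · rw [← ofReal_norm, ← ofReal_norm]
          exact ENNReal.ofReal_le_ofReal (PiLp.norm_apply_le _ _)
        · exact h1 i
    _ = _ := by simp [mul_assoc]

/-- The fundamental theorem of calculus on the segment from x to x + h, then Jensen in the segment
parameter. -/
theorem enorm_mollify_sub_rpow_le (hq : 1 ≤ q) (φ : ContDiffBump (0 : EuclideanSpace ℝ (Fin n)))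
    (hfg : IsWeakGradient f g) {Γ : EuclideanSpace ℝ (Fin n) → ℝ≥0∞} (hΓ : Measurable Γ)
    (hgΓ : ∀ᵐ x, ‖g x‖ₑ = Γ x) (x h : EuclideanSpace ℝ (Fin n)) :
    ‖mollify φ f (x + h) - mollify φ f x‖ₑ ^ q ≤ (n : ℝ≥0∞) ^ q * ‖h‖ₑ ^ q *
      ∫⁻ t in Ioc (0 : ℝ) 1, (∫⁻ s, Γ (x + t • h - s) ∂bumpMeasure φ) ^ q := by
  have hq0 : 0 ≤ q := by linarith
  have hd := contDiff_mollify φ hfg.1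
  have hG : Measurable fun y => ∫⁻ s, Γ (y - s) ∂bumpMeasure φ :=
    (show Measurable fun z : EuclideanSpace ℝ (Fin n) × EuclideanSpace ℝ (Fin n) =>
      Γ (z.1 - z.2) by fun_prop).lintegral_prod_right'
  have h1 : ∫ t in (0 : ℝ)..1, fderiv ℝ (mollify φ f) (x + t • h) h =
      mollify φ f (x + h) - mollify φ f x := by
    have h2 := intervalIntegral.integral_eq_sub_of_hasDerivAt (a := 0) (b := 1)
      (f := fun t : ℝ => mollify φ f (x + t • h))
      (f' := fun t : ℝ => fderiv ℝ (mollify φ f) (x + t • h) h) (fun t _ => ?_) ?_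
    · simpa using h2
    · have h3 : HasDerivAt (fun t : ℝ => x + t • h) h t := by
        simpa using ((hasDerivAt_id t).smul_const h).const_add x
      exact ((hd.differentiable one_ne_zero _).hasFDerivAt.comp_hasDerivAt t h3)
    · refine Continuous.intervalIntegrable ?_ _ _
      have := hd.continuous_fderiv one_ne_zero
      fun_prop
  rw [← h1, intervalIntegral.integral_of_le zero_le_one]
  have : IsProbabilityMeasure (volume.restrict (Ioc (0 : ℝ) 1)) := ⟨by simp⟩
  calc ‖∫ t in Ioc (0 : ℝ) 1, fderiv ℝ (mollify φ f) (x + t • h) h‖ₑ ^ q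
      ≤ (∫⁻ t in Ioc (0 : ℝ) 1, n * ‖h‖ₑ * ∫⁻ s, Γ (x + t • h - s) ∂bumpMeasure φ) ^ q := by
        refine ENNReal.rpow_le_rpow ((enorm_integral_le_lintegral_enorm _).trans
          (lintegral_mono fun t => ?_)) hq0
        exact enorm_fderiv_mollify_le φ hfg hΓ hgΓ _ _
    _ = (n : ℝ≥0∞) ^ q * ‖h‖ₑ ^ q *
          (∫⁻ t in Ioc (0 : ℝ) 1, ∫⁻ s, Γ (x + t • h - s) ∂bumpMeasure φ) ^ q := by
        rw [lintegral_const_mul' _ _ (by finiteness), ENNReal.mul_rpow_of_nonneg _ _ hq0,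
          ENNReal.mul_rpow_of_nonneg _ _ hq0]
    _ ≤ _ := by
        gcongr
        refine rpow_lintegral_le _ (Measurable.aemeasurable ?_) hq
        exact hG.comp (by fun_prop : Measurable fun t : ℝ => x + t • h)

theorem lintegral_rpow_bump_le {γ : ℝ} (hγ : 1 ≤ γ)
    (φ : ContDiffBump (0 : EuclideanSpace ℝ (Fin n)))
    {Γ : EuclideanSpace ℝ (Fin n) → ℝ≥0∞} (hΓ : Measurable Γ) :
    ∫⁻ x, (∫⁻ s, Γ (x - s) ∂bumpMeasure φ) ^ γ ≤ ∫⁻ x, Γ x ^ γ := by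
  have hm : Measurable fun z : EuclideanSpace ℝ (Fin n) × EuclideanSpace ℝ (Fin n) =>
      Γ (z.1 - z.2) ^ γ := by fun_prop
  calc ∫⁻ x, (∫⁻ s, Γ (x - s) ∂bumpMeasure φ) ^ γ
      ≤ ∫⁻ x, ∫⁻ s, Γ (x - s) ^ γ ∂bumpMeasure φ :=
        lintegral_mono fun x => rpow_lintegral_le _ (by fun_prop) hγ
    _ = ∫⁻ s, (∫⁻ x, Γ (x - s) ^ γ) ∂bumpMeasure φ := lintegral_lintegral_swap hm.aemeasurable
    _ = _ := by
        simp_rw [lintegral_sub_right_eq_self (fun x => Γ x ^ γ)]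
        simp

/-- The gain |h|^q turns the kernel into |h|^{q-n-qα}, integrable near 0 because α < 1. The bound
stays local to Q because segments between points of a convex cube stay inside it, and translation
invariance evaluates the integral over x for each h and t. -/
theorem exists_energy_le_of_forall_le (hn : 1 ≤ n) (hq : 1 ≤ q) (hα : α < 1) :
    ∃ C : ℝ≥0∞, C ≠ ∞ ∧ ∀ (v : EuclideanSpace ℝ (Fin n) → 𝕜)
      (H : EuclideanSpace ℝ (Fin n) → ℝ≥0∞) (M : ℝ≥0∞), Measurable v → Measurable H → M ≠ ∞ →
      (∀ x h, ‖v (x + h) - v x‖ₑ ^ q ≤ M * ‖h‖ₑ ^ q * ∫⁻ t in Ioc (0 : ℝ) 1, H (x + t • h)) →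
      ∀ ℓ : ℝ, 0 < ℓ → ∀ Q, IsCube ℓ Q →
        energy q (n + q * α) v Q Q ≤
          M * C * ENNReal.ofReal ℓ ^ (q * (1 - α)) * ∫⁻ x in Q, H x := by
  have hn' : 0 < √(n : ℝ) := Real.sqrt_pos.2 (by exact_mod_cast hn)
  have hq0 : 0 < q := by linarith
  have hqα : 0 < q * (1 - α) := mul_pos hq0 (by linarith)
  obtain ⟨c, hct, hc⟩ := exists_setLIntegral_ball_eq hn (β := n + q * α - q) (by linarith)
  refine ⟨c * ENNReal.ofReal (2 * √n) ^ (q * (1 - α)), ENNReal.mul_ne_top hct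
    (ENNReal.rpow_ne_top_of_nonneg hqα.le ENNReal.ofReal_ne_top),
    fun v H M hv hH hM hvH ℓ hℓ Q hQ => ?_⟩
  set β : ℝ := n + q * α with hβ
  obtain ⟨a, -, -, haQ⟩ := hQ.exists_openCube
  set U := openCube a ℓ with hU
  have hUo : MeasurableSet U := (isOpen_openCube a ℓ).measurableSet
  have hUc := convex_openCube a ℓ
  set B := Metric.ball (0 : EuclideanSpace ℝ (Fin n)) (2 * √n * ℓ) with hB
  have hpt : ∀ x h, U.indicator (fun x => U.indicator
      (fun y => ‖v x - v y‖ₑ ^ q / ‖x - y‖ₑ ^ β) (x + h)) x ≤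
      M * (B.indicator (fun h => (‖h‖ₑ ^ (β - q))⁻¹) h *
        ∫⁻ t in Ioc (0 : ℝ) 1, U.indicator H (x + t • h)) := by
    intro x h
    by_cases hx : x ∈ U
    swap
    · rw [indicator_of_notMem hx]
      exact zero_le
    by_cases hy : x + h ∈ U
    swap
    · rw [indicator_of_mem hx, indicator_of_notMem hy]
      exact zero_le
    rw [indicator_of_mem hx, indicator_of_mem hy, enorm_sub_rev (v x), enorm_sub_rev x,
      add_sub_cancel_left]
    rcases eq_or_ne h 0 with rfl | hh
    · simp [ENNReal.zero_rpow_of_pos hq0]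
    have hhB : h ∈ B := by
      rw [hB, mem_ball_zero_iff]
      have h1 := (isCube_openCube a ℓ).enorm_sub_le hℓ hy hx
      rw [add_sub_cancel_left, ← ofReal_norm, ENNReal.ofReal_le_ofReal_iff (by positivity)] at h1
      nlinarith [mul_pos hn' hℓ]
    have h0 : ‖h‖ₑ ≠ 0 := by simpa using hh
    -- Convexity lets H be cut off to U, which must happen before x is allowed to range over the
    -- whole space.
    have hline : ∫⁻ t in Ioc (0 : ℝ) 1, U.indicator H (x + t • h) =
        ∫⁻ t in Ioc (0 : ℝ) 1, H (x + t • h) := by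
      refine setLIntegral_congr_fun measurableSet_Ioc fun t ht => ?_
      exact indicator_of_mem (hUc.add_smul_mem hx hy ⟨ht.1.le, ht.2⟩) _
    rw [indicator_of_mem hhB, hline]
    refine (ENNReal.div_le_div_right (hvH x h) _).trans_eq ?_
    rw [← ENNReal.rpow_neg, show -(β - q) = q + -β by ring,
      ENNReal.rpow_add q (-β) h0 enorm_ne_top, ENNReal.rpow_neg _ β, div_eq_mul_inv]
    ring
  have hm : Measurable fun z : EuclideanSpace ℝ (Fin n) × EuclideanSpace ℝ (Fin n) =>
      B.indicator (fun h => (‖h‖ₑ ^ (β - q))⁻¹) z.2 *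
        ∫⁻ t in Ioc (0 : ℝ) 1, U.indicator H (z.1 + t • z.2) := by
    have h1 : Measurable (B.indicator fun h : EuclideanSpace ℝ (Fin n) => (‖h‖ₑ ^ (β - q))⁻¹) :=
      Measurable.indicator (by fun_prop) Metric.isOpen_ball.measurableSet
    have h2 : Measurable fun w : (EuclideanSpace ℝ (Fin n) × EuclideanSpace ℝ (Fin n)) × ℝ =>
        U.indicator H (w.1.1 + w.2 • w.1.2) := (hH.indicator hUo).comp (by fun_prop)
    exact (h1.comp measurable_snd).mul h2.lintegral_prod_right'
  have hHx : ∀ h, ∫⁻ x, ∫⁻ t in Ioc (0 : ℝ) 1, U.indicator H (x + t • h) = ∫⁻ x in U, H x := by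
    intro h
    have h2 : Measurable fun w : EuclideanSpace ℝ (Fin n) × ℝ => U.indicator H (w.1 + w.2 • h) :=
      (hH.indicator hUo).comp (by fun_prop)
    rw [lintegral_lintegral_swap h2.aemeasurable]
    simp_rw [lintegral_add_right_eq_self (U.indicator H)]
    rw [lintegral_indicator hUo]
    simp
  calc energy q β v Q Q = energy q β v U U := by
        unfold energy
        rw [Measure.restrict_congr_set haQ]
    _ = ∫⁻ x, ∫⁻ h, U.indicator (fun x => U.indicator
          (fun y => ‖v x - v y‖ₑ ^ q / ‖x - y‖ₑ ^ β) (x + h)) x := by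
        unfold energy
        rw [← lintegral_indicator hUo]
        refine lintegral_congr fun x => ?_
        by_cases hx : x ∈ U
        · simp_rw [indicator_of_mem hx]
          rw [lintegral_add_left_eq_self (U.indicator _) x, lintegral_indicator hUo]
        · simp [indicator_of_notMem hx]
    _ ≤ ∫⁻ x, ∫⁻ h, M * (B.indicator (fun h => (‖h‖ₑ ^ (β - q))⁻¹) h *
          ∫⁻ t in Ioc (0 : ℝ) 1, U.indicator H (x + t • h)) :=
        lintegral_mono fun x => lintegral_mono fun h => hpt x h
    _ = M * ∫⁻ h, ∫⁻ x, B.indicator (fun h => (‖h‖ₑ ^ (β - q))⁻¹) h *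
          ∫⁻ t in Ioc (0 : ℝ) 1, U.indicator H (x + t • h) := by
        have hswap := lintegral_lintegral_swap (μ := volume) (ν := volume)
          (f := fun x h => B.indicator (fun h => (‖h‖ₑ ^ (β - q))⁻¹) h *
            ∫⁻ t in Ioc (0 : ℝ) 1, U.indicator H (x + t • h)) hm.aemeasurable
        rw [← hswap, ← lintegral_const_mul' _ _ hM]
        simp_rw [lintegral_const_mul' _ _ hM]
    _ = M * ∫⁻ h, B.indicator (fun h => (‖h‖ₑ ^ (β - q))⁻¹) h * ∫⁻ x in U, H x := by
        congr 1
        refine lintegral_congr fun h => ?_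
        have h2 : Measurable fun w : EuclideanSpace ℝ (Fin n) × ℝ =>
          U.indicator H (w.1 + w.2 • h) := (hH.indicator hUo).comp (by fun_prop)
        rw [lintegral_const_mul _ h2.lintegral_prod_right', hHx h]
    _ = M * ((∫⁻ h in B, (‖h‖ₑ ^ (β - q))⁻¹) * ∫⁻ x in U, H x) := by
        rw [lintegral_mul_const _
          (Measurable.indicator (by fun_prop) Metric.isOpen_ball.measurableSet),
          lintegral_indicator Metric.isOpen_ball.measurableSet]
    _ = _ := by
        rw [hB, hc _ (by positivity), Measure.restrict_congr_set haQ,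
          show (n : ℝ) - (β - q) = q * (1 - α) by rw [hβ]; ring,
          ENNReal.ofReal_mul (by positivity) (q := ℓ), ENNReal.mul_rpow_of_nonneg _ _ hqα.le]
        ring

theorem energy_le_liminf {β : ℝ} {v : ℕ → EuclideanSpace ℝ (Fin n) → 𝕜}
    (hv : ∀ k, Measurable (v k))
    (hlim : ∀ᵐ x, Filter.Tendsto (fun k => v k x) Filter.atTop (nhds (f x)))
    (A B : Set (EuclideanSpace ℝ (Fin n))) (hq : 0 < q) :
    energy q β f A B ≤ Filter.liminf (fun k => energy q β (v k) A B) Filter.atTop := by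
  have hm := fun k => measurable_energy_integrand (hv k) q β
  unfold energy
  refine le_trans ?_ (lintegral_liminf_le fun k => (hm k).lintegral_prod_right')
  refine lintegral_mono_ae (ae_restrict_of_ae ?_)
  filter_upwards [hlim] with x hx
  refine le_trans ?_ (lintegral_liminf_le fun k => (hm k).comp measurable_prodMk_left)
  refine lintegral_mono_ae (ae_restrict_of_ae ?_)
  filter_upwards [hlim] with y hy
  rcases eq_or_ne x y with rfl | hxy
  · simp [ENNReal.zero_rpow_of_pos hq]
  · refine (Filter.Tendsto.liminf_eq ?_).ge
    have h0 : ‖x - y‖ₑ ≠ 0 := by simpa [sub_eq_zero] using hxy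
    have h1 : Filter.Tendsto (fun k => ‖v k x - v k y‖ₑ ^ q) Filter.atTop
        (nhds (‖f x - f y‖ₑ ^ q)) :=
      (ENNReal.continuous_rpow_const.tendsto _).comp ((hx.sub hy).enorm)
    exact ENNReal.Tendsto.div_const h1 (Or.inr (by simp [ENNReal.rpow_eq_zero_iff, h0]))

/-- Fatou is used in the double integral and again in the sum over cubes; the outer power is
continuous and monotone, so it commutes with the lower limit. -/
theorem congruentSup_phi_lt_top_of_tendsto (hn : 1 ≤ n) (hp : 0 < p) (hq : 0 < q)
    {v : ℕ → EuclideanSpace ℝ (Fin n) → 𝕜} (hv : ∀ k, Measurable (v k))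
    (hlim : ∀ᵐ x, Filter.Tendsto (fun k => v k x) Filter.atTop (nhds (f x)))
    {C : ℝ≥0∞} (hC : C ≠ ∞) (h : ∀ k, ∀ ℓ : ℝ, 0 < ℓ → ∀ S ∈ congruentCollections n ℓ,
      ∑' Q : S, volume (Q : Set (EuclideanSpace ℝ (Fin n))) * phi q α (v k) Q ^ p ≤ C) :
    congruentSup p (phi q α f) < ∞ := by
  refine congruentSup_lt_top hp hC fun ℓ hℓ S hS => ?_
  have hcube : ∀ Q : S, volume (Q : Set (EuclideanSpace ℝ (Fin n))) * phi q α f Q ^ p ≤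
      Filter.liminf (fun k => volume (Q : Set (EuclideanSpace ℝ (Fin n))) *
        phi q α (v k) Q ^ p) Filter.atTop := fun Q => by
    have hQ := hS.1 Q Q.2
    simp_rw [volume_mul_phi_rpow_eq hn hp hq _ hℓ hQ]
    set c := ENNReal.ofReal ℓ ^ (q * (α - n * (1 / q - 1 / p)))
    have hct : c ≠ ∞ := ENNReal.rpow_ne_top_of_ne_zero (by simpa using hℓ) ENNReal.ofReal_ne_top
    have hmono : Monotone fun t : ℝ≥0∞ => (c * t) ^ (p / q) := fun s t hst =>
      ENNReal.rpow_le_rpow (mul_le_mul_right hst _) (by positivity)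
    have hcont : Continuous fun t : ℝ≥0∞ => (c * t) ^ (p / q) :=
      ENNReal.continuous_rpow_const.comp (ENNReal.continuous_const_mul hct)
    have h1 := hmono.map_liminf_of_continuousAt
      (F := Filter.atTop) (fun k => energy q (n + q * α) (v k) Q Q) hcont.continuousAt
    exact (hmono (energy_le_liminf hv hlim _ _ hq)).trans_eq h1
  refine (ENNReal.tsum_le_tsum hcube).trans ?_
  -- The sum is viewed as an integral for counting measure, so that Fatou applies to it.
  let _ : MeasurableSpace S := ⊤
  have : MeasurableSingletonClass S := ⟨fun _ => trivial⟩
  rw [← lintegral_count]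
  refine (lintegral_liminf_le fun k => measurable_from_top).trans ?_
  simp_rw [lintegral_count]
  exact (Filter.liminf_le_liminf (.of_forall fun k => h k ℓ hℓ S hS)).trans_eq
    (Filter.liminf_const C)

/-- α₀ ≥ 1 says exactly q ≤ γ, and always γ ≤ p. The first inequality lets Jensen raise the exponent
from q to γ on each cube, the second allows summation with power p/γ. -/
theorem homSobolev_subset_JNQ (hn : 1 ≤ n) (hp : 1 ≤ p) (hq : 1 ≤ q)
    (h1 : 1 ≤ n * (1 / q - 1 / p)) (hα : α < 1) :
    homSobolev 𝕜 n (1 / p + 1 / n)⁻¹ ⊆ JNQ 𝕜 n p q α := by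
  have hp0 : 0 < p := by linarith
  have hq0 : 0 < q := by linarith
  have hn0 : (0 : ℝ) < n := by exact_mod_cast hn
  set γ : ℝ := (1 / p + 1 / n)⁻¹ with hγ
  have hγ0 : 0 < γ := by positivity
  have hγi : 1 / γ = 1 / p + 1 / n := by rw [hγ, one_div, inv_inv]
  have hqγ : q ≤ γ := by
    refine le_of_one_div_le_one_div hγ0 ?_
    rw [hγi]
    have : 1 / (n : ℝ) ≤ 1 / q - 1 / p := by
      rw [div_le_iff₀' hn0]
      exact h1
    linarith
  have hγp : γ ≤ p := by
    refine le_of_one_div_le_one_div hp0 ?_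
    rw [hγi]
    have : 0 < 1 / (n : ℝ) := by positivity
    linarith
  rintro f ⟨g, hfg, hgγ⟩
  refine ⟨hfg.1.aestronglyMeasurable, ?_⟩
  rw [one_div γ, ENNReal.rpow_lt_top_iff_of_pos (by positivity)] at hgγ
  have hgm : AEMeasurable (fun x => ‖g x‖ₑ) volume := hfg.2.1.aestronglyMeasurable.enorm
  set Γ := hgm.mk _
  have hΓ : Measurable Γ := hgm.measurable_mk
  have hgΓ : ∀ᵐ x, ‖g x‖ₑ = Γ x := hgm.ae_eq_mk
  have hΓγ : ∫⁻ x, Γ x ^ γ ≠ ∞ := by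
    refine ne_of_eq_of_ne (lintegral_congr_ae ?_) hgγ.ne
    filter_upwards [hgΓ] with x hx
    rw [hx]
  -- The fixed ratio 2 of outer to inner radius is what gives convergence almost everywhere for a
  -- merely locally integrable f.
  let φ : ℕ → ContDiffBump (0 : EuclideanSpace ℝ (Fin n)) := fun k =>
    ⟨1 / (2 * ((k : ℝ) + 1)), 1 / ((k : ℝ) + 1), by positivity, by
      rw [div_lt_div_iff₀ (by positivity) (by positivity)]
      have : (0 : ℝ) ≤ k := by positivity
      linarith⟩
  have hlim : ∀ᵐ x, Filter.Tendsto (fun k => mollify (φ k) f x) Filter.atTop (nhds (f x)) := by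
    refine ContDiffBump.ae_convolution_tendsto_right_of_locallyIntegrable (K := 2)
      tendsto_one_div_add_atTop_nhds_zero_nat (.of_forall fun k => le_of_eq ?_) hfg.1
    change 1 / ((k : ℝ) + 1) = 2 * (1 / (2 * ((k : ℝ) + 1)))
    field_simp
  obtain ⟨C, hCt, hC⟩ := exists_energy_le_of_forall_le (𝕜 := 𝕜) hn hq hα
  set M : ℝ≥0∞ := (n : ℝ≥0∞) ^ q with hM
  have hMt : M ≠ ∞ := ENNReal.rpow_ne_top_of_nonneg hq0.le (by simp)
  set D : ℝ≥0∞ := (M * C) ^ (γ / q) with hD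
  have hDt : D ≠ ∞ := ENNReal.rpow_ne_top_of_nonneg (by positivity) (ENNReal.mul_ne_top hMt hCt)
  have hγp' : 1 ≤ p / γ := (one_le_div hγ0).2 hγp
  have hcd := fun k => contDiff_mollify (φ k) hfg.1
  refine congruentSup_phi_lt_top_of_tendsto hn hp0 hq0
    (fun k => (hcd k).continuous.measurable) hlim (C := (D * ∫⁻ x, Γ x ^ γ) ^ (p / γ))
    (ENNReal.rpow_ne_top_of_nonneg (by positivity) (ENNReal.mul_ne_top hDt hΓγ))
    fun k ℓ hℓ S hS => ?_
  set G : EuclideanSpace ℝ (Fin n) → ℝ≥0∞ := fun x => ∫⁻ s, Γ (x - s) ∂bumpMeasure (φ k)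
  have hG : Measurable G :=
    (show Measurable fun z : EuclideanSpace ℝ (Fin n) × EuclideanSpace ℝ (Fin n) =>
      Γ (z.1 - z.2) by fun_prop).lintegral_prod_right'
  have hcube : ∀ Q : S, volume (Q : Set (EuclideanSpace ℝ (Fin n))) *
      phi q α (mollify (φ k) f) Q ^ p ≤
        (D * ∫⁻ x in (Q : Set (EuclideanSpace ℝ (Fin n))), G x ^ γ) ^ (p / γ) := by
    rintro ⟨Q, hQS⟩
    have hQ := hS.1 Q hQS
    have hL0 : ENNReal.ofReal ℓ ≠ 0 := by simpa using hℓ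
    have hLt : ENNReal.ofReal ℓ ≠ ∞ := ENNReal.ofReal_ne_top
    have hV0 := hQ.volume_ne_zero hℓ
    have hVt := hQ.volume_ne_top
    change volume Q * phi q α (mollify (φ k) f) Q ^ p ≤ (D * ∫⁻ x in Q, G x ^ γ) ^ (p / γ)
    have hen := hC (mollify (φ k) f) (fun x => G x ^ q) M (hcd k).continuous.measurable
      (by fun_prop) hMt (fun x h => enorm_mollify_sub_rpow_le hq (φ k) hfg hΓ hgΓ x h) ℓ hℓ Q hQ
    have hJ := rpow_setLIntegral_le hV0 hVt (g := fun x => G x ^ q) (q := γ / q)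
      (by fun_prop) ((one_le_div hq0).2 hqγ)
    simp_rw [← ENNReal.rpow_mul, mul_div_cancel₀ γ hq0.ne'] at hJ
    rw [volume_mul_phi_rpow_eq hn hp0 hq0 _ hℓ hQ]
    set I := ∫⁻ x in Q, G x ^ q
    set I' := ∫⁻ x in Q, G x ^ γ
    set L := ENNReal.ofReal ℓ
    set e := q * (1 - n * (1 / q - 1 / p)) with he
    calc (L ^ (q * (α - n * (1 / q - 1 / p))) * energy q (n + q * α) (mollify (φ k) f) Q Q) ^ (p / q)
        ≤ (L ^ (q * (α - n * (1 / q - 1 / p))) *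
            (M * C * L ^ (q * (1 - α)) * I)) ^ (p / q) := by gcongr
      _ = (M * C * (L ^ e * I)) ^ (p / q) := by
          congr 1
          rw [show e = q * (α - n * (1 / q - 1 / p)) + q * (1 - α) by rw [he]; ring,
            ENNReal.rpow_add _ _ hL0 hLt]
          ring
      _ = ((M * C * (L ^ e * I)) ^ (γ / q)) ^ (p / γ) := by
          rw [← ENNReal.rpow_mul]
          congr 1
          field_simp
      _ = (D * (L ^ (e * (γ / q)) * volume Q ^ (γ / q) * ((volume Q)⁻¹ * I) ^ (γ / q))) ^
            (p / γ) := by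
          congr 1
          rw [ENNReal.mul_rpow_of_nonneg (M * C) _ (by positivity),
            ENNReal.mul_rpow_of_nonneg _ I (by positivity), ENNReal.rpow_mul L e, mul_assoc (_ ^ _),
            ← ENNReal.mul_rpow_of_nonneg (volume Q) _ (by positivity), ← mul_assoc (volume Q),
            ENNReal.mul_inv_cancel hV0 hVt, one_mul]
      _ ≤ (D * (L ^ (e * (γ / q)) * volume Q ^ (γ / q) * ((volume Q)⁻¹ * I'))) ^ (p / γ) := by
          gcongr
      _ = (D * I') ^ (p / γ) := by
          -- The exponent of ℓ is γ(1 - α₀) + nγ/q - n = γ(1 + n/p) - n, which is zero exactly for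
          -- this γ.
          have : L ^ (e * (γ / q)) * volume Q ^ (γ / q) * (volume Q)⁻¹ = 1 := by
            rw [hQ.volume_eq_rpow, ← ENNReal.rpow_neg, ← ENNReal.rpow_mul,
              ← ENNReal.rpow_add _ _ hL0 hLt, ← ENNReal.rpow_add _ _ hL0 hLt,
              ← ENNReal.rpow_zero (x := L)]
            congr 1
            rw [he, hγ]
            field_simp
            ring
          rw [← mul_assoc _ (volume Q)⁻¹, this, one_mul]
  refine (ENNReal.tsum_le_tsum hcube).trans ((tsum_rpow_le_rpow_tsum _ hγp').trans ?_)
  rw [ENNReal.tsum_mul_left]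
  gcongr
  exact (tsum_setLIntegral_le hℓ hS _).trans (lintegral_rpow_bump_le (by linarith) (φ k) hΓ)

end Mollification

end JNQSpaces

open JNQSpaces
theorem theorem2p17 {𝕜 : Type*} [RCLike 𝕜] (n : ℕ) (hn : 1 ≤ n) (p q α α₀ : ℝ)
    (hp : 1 ≤ p) (hq : 1 ≤ q) (hα₀ : α₀ = n * (1 / q - 1 / p)) :
    (α₀ < 0 → JNQ 𝕜 n p q α = aeConstants 𝕜 n) ∧
    (α₀ = 0 →
      (α < 0 → JNQ 𝕜 n p q α = JNcon 𝕜 n p p) ∧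
      (0 ≤ α → JNQ 𝕜 n p q α = aeConstants 𝕜 n)) ∧
    (0 < α₀ → α₀ < 1 →
      (α < 0 → JNQ 𝕜 n p q α = JNcon 𝕜 n p q) ∧
      (0 ≤ α → α ≤ α₀ → fracSobolev 𝕜 n α₀ q ⊆ JNQ 𝕜 n p q α) ∧
      (α₀ < α → JNQ 𝕜 n p q α = aeConstants 𝕜 n)) ∧
    (1 ≤ α₀ →
      (α < 0 → JNQ 𝕜 n p q α = JNcon 𝕜 n p q) ∧
      (0 ≤ α → α < 1 → homSobolev 𝕜 n (1 / p + 1 / n)⁻¹ ⊆ JNQ 𝕜 n p q α) ∧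
      (1 ≤ α → JNQ 𝕜 n p q α = aeConstants 𝕜 n)) := by
  subst hα₀
  refine ⟨JNQ_eq_aeConstants_of_neg hn hp hq, fun h0 => ?_,
    fun h0 _ => ⟨JNQ_eq_JNcon hn hp hq, fun _ => fracSobolev_subset_JNQ hn hp hq h0,
      JNQ_eq_aeConstants_of_lt hn hp hq⟩,
    fun h1 => ⟨JNQ_eq_JNcon hn hp hq, fun _ => homSobolev_subset_JNQ hn hp hq h1,
      JNQ_eq_aeConstants_of_one_le hn hp hq⟩⟩
  -- α₀ = 0 forces q = p, which is why the second index of the John–Nirenberg space can be written p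
  -- in this case.
  have hqp : q = p := by
    have hn0 : (n : ℝ) ≠ 0 := by positivity
    have h1 : 1 / q = 1 / p := sub_eq_zero.1 ((mul_eq_zero.1 h0).resolve_left hn0)
    simpa using h1
  subst hqp
  refine ⟨JNQ_eq_JNcon hn hp hq, fun hα => ?_⟩
  rcases hα.eq_or_lt with rfl | hα
  · exact JNQ_zero_eq_aeConstants hn hp
  · exact JNQ_eq_aeConstants_of_lt hn hp hq (by rwa [h0])
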